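/- **Setting.** A *sequence of instructions* is a walk $x_0=0,x_1,x_2,\dots$ in $\mathbb Z^2$ whose increments are unit steps $(\pm1,0),(0,\pm1)$; it may be random. Given $p\in[0,1]$, the *guided random walk* following it is the process with $X_0=0$ such that, independently in each step $t$ and independently of the instructions, $X_{t+1}-X_t=x_{t+1}-x_t$ with probability $1-p$, and $X_{t+1}-X_t$ is uniform on $\{(\pm1,0),(0,\pm1)\}$ with probability $p$. For $x_{\mathrm{home}}\in\mathbb Z^2$ let $T=\inf\{t\ge 0: X_t=x_{\mathrm{home}}\}\in[0,\infty]$. **The sweeping strategy** with parameters $A,B>0$ and $p_0\in(0,1)$. The first two instructions are one step east and one step west; after that the instructions consist of consecutive phases, the first of which starts at time $2$. Each phase starts and ends at the origin. For a phase starting at time $t$ let $$W=\Big\lceil \tfrac{A\sqrt t}{1-p_0}\Big\rceil,\quad H=\Big\lceil \tfrac{B\sqrt t}{1-p_0}\Big\rceil,\quad G=\Big\lceil \tfrac{1}{1-p_0}\tfrac{\sqrt t}{\ln t}\Big\rceil,\quad N=\Big\lceil \tfrac{2H}{G}\Big\rceil,\quad M=G+\lceil t^{1/3}\rceil,$$ and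 let $Z$ be uniform on $\{1,\dots,M\}$, independently for different phases. The instructions of the phase are: 1. move $W$ steps west and then $H$ steps south, to $(-W,-H)$; 2. move $Z$ steps north; 3. traverse $N$ horizontal lines at vertical distance $G$: $2W$ steps east, $G$ steps north, $2W$ steps west, $G$ steps north, and so on, ending with the $N$-th line; 4. move $M-Z$ steps north, and then return to $(0,0)$, first horizontally and then vertically. (The duration of a phase does not depend on $Z$, so the starting times of the phases are deterministic.) **Theorem.** The function $g(b)=\frac{1}{2b^2}\left(1-4e^{-b^2/4+2}\right)$ on $b>0$ has a maximizer $a=4.566\dots$, and the equation $\frac{p_0\sqrt{3-2p_0}}{(1-p_0)^2}=g(a)$ has a solution $p_0=0.01139\dots$. For the sweeping strategy with parameters $A=a\sqrt{\frac{p_0}{2}(3-2p_0)}$, $B=a\sqrt{\frac{p_0}{2}}$ and $p_0$, the following holds: for every $0\le p<p_0$ and every $x_{\mathrm{home}}\in\mathbb Z^2$, the guided random walk following this one (random) sequence of instructions, whose law depends neither on $p$ nor on $x_{\mathrm{home}}$, satisfies $\mathbb E[T]<\infty$, the expectation being over the offsets $Z$ and the errors of the agent. -/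

import Mathlib

open MeasureTheory ProbabilityTheory
open scoped ENNReal

/-! ### Guided random walks on `ℤ²` -/

/-- The four unit steps east, west, north, south. -/
def unitSteps : Finset (ℤ × ℤ) := {(1, 0), (-1, 0), (0, 1), (0, -1)}

/-- The randomness of one time step: a flag telling whether the agent makes a mistake
(probability `p`), and, independently, a uniformly random unit step. -/
noncomputable def stepNoiseLaw (p : unitInterval) : Measure (Bool × (ℤ × ℤ)) :=
  (bernoulliMeasure true false p).prod (uniformOn (unitSteps : Set (ℤ × ℤ)))

/-- The randomness of the agent: independent noise in all time steps. -/
noncomputable def noiseLaw (p : unitInterval) : Measure (ℕ → Bool × (ℤ × ℤ)) :=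
  Measure.infinitePi fun _ => stepNoiseLaw p

/-- The guided random walk following the walk of instructions `x`, driven by the noise `ω`:
in each step the agent follows the instruction, unless it makes a mistake,
in which case it performs the random unit step. -/
def guidedWalk (x : ℕ → ℤ × ℤ) (ω : ℕ → Bool × (ℤ × ℤ)) : ℕ → ℤ × ℤ
  | 0 => 0
  | t + 1 => guidedWalk x ω t + if (ω t).1 then (ω t).2 else x (t + 1) - x t

/-- The first time at which the path `X` is at `home` (`∞` if there is none). -/
noncomputable def hittingTime (X : ℕ → ℤ × ℤ) (home : ℤ × ℤ) : ℝ≥0∞ :=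
  ⨅ (t : ℕ) (_ : X t = home), (t : ℝ≥0∞)

/-! ### The sweeping strategy -/

/-- The real parameters of the sweeping strategy. -/
structure SweepParams where
  A : ℝ
  B : ℝ
  p₀ : ℝ

namespace SweepParams

variable (P : SweepParams)

/-- Half the width of the box swept in a phase that starts at time `t`. -/
noncomputable def W (t : ℕ) : ℕ := ⌈1 / (1 - P.p₀) * (P.A * √(t : ℝ))⌉₊

/-- Half the height of the box swept in a phase that starts at time `t`. -/
noncomputable def H (t : ℕ) : ℕ := ⌈1 / (1 - P.p₀) * (P.B * √(t : ℝ))⌉₊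

/-- The vertical gap between consecutive lines. -/
noncomputable def G (t : ℕ) : ℕ := ⌈1 / (1 - P.p₀) * (√(t : ℝ) / Real.log t)⌉₊

/-- The number of horizontal lines. -/
noncomputable def N (t : ℕ) : ℕ := ⌈(2 * P.H t : ℝ) / P.G t⌉₊

/-- The largest possible vertical offset. -/
noncomputable def M (t : ℕ) : ℕ := P.G t + ⌈(t : ℝ) ^ (1 / 3 : ℝ)⌉₊

end SweepParams

/-- `n` horizontal lines of length `2 * W` at vertical distance `G`, traversed alternatingly
eastwards and westwards from bottom to top; the first one goes east iff `east` is true. -/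
def sweepLines (W G : ℕ) : ℕ → Bool → List (ℤ × ℤ)
  | 0, _ => []
  | 1, east => List.replicate (2 * W) (if east then (1, 0) else (-1, 0))
  | n + 2, east => List.replicate (2 * W) (if east then (1, 0) else (-1, 0)) ++
      List.replicate G (0, 1) ++ sweepLines W G (n + 1) (!east)

namespace SweepParams

variable (P : SweepParams)

/-- The instructions of a phase that starts at time `t`, with vertical offset `z`:
go to the south-west corner `(-W, -H)`, go `z` steps north, traverse the lines,
go `M - z` steps north, and return to the origin (first horizontally, then vertically). -/
noncomputable def phase (t z : ℕ) : List (ℤ × ℤ) :=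
  List.replicate (P.W t) (-1, 0) ++ List.replicate (P.H t) (0, -1) ++
  List.replicate z (0, 1) ++
  sweepLines (P.W t) (P.G t) (P.N t) true ++
  List.replicate (P.M t - z) (0, 1) ++
  List.replicate (P.W t) (if Odd (P.N t) then (-1, 0) else (1, 0)) ++
  List.replicate ((P.N t - 1) * P.G t + P.M t - P.H t) (0, -1)

/-- The start time of the `i`-th phase; the duration of a phase does not depend on its offset. -/
noncomputable def startTime : ℕ → ℕ
  | 0 => 2
  | i + 1 => startTime i + (P.phase (startTime i) 0).length

/-- The instructions up to the start of the `i`-th phase when the offsets are `z 0, z 1, …`.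
The first phase starts at time `2`, after one step east and one step west. -/
noncomputable def instructions (z : ℕ → ℕ) : ℕ → List (ℤ × ℤ)
  | 0 => [(1, 0), (-1, 0)]
  | i + 1 => instructions z i ++ P.phase (P.startTime i) (z i)

/-- The walk `x` of instructions: `x t` is the sum of the first `t` instructions
(these are contained in the first `t` phases, every phase being nonempty). -/
noncomputable def sweepWalk (z : ℕ → ℕ) (t : ℕ) : ℤ × ℤ :=
  ((P.instructions z t).take t).sum

/-- The law of the offsets: independent, the `i`-th one being uniform on `{1, …, M}`. -/
noncomputable def offsetLaw : Measure (ℕ → ℕ) :=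
  Measure.infinitePi fun i => uniformOn (Set.Icc 1 (P.M (P.startTime i)))

/-- The joint law of the offsets of the strategy and of the independent noise of the agent. -/
noncomputable def law (p : unitInterval) : Measure ((ℕ → ℕ) × (ℕ → Bool × (ℤ × ℤ))) :=
  P.offsetLaw.prod (noiseLaw p)

/-- The expected hitting time of `home` for the guided random walk with error probability `p`
that follows the sweeping strategy. -/
noncomputable def expectedHittingTime (p : unitInterval) (home : ℤ × ℤ) : ℝ≥0∞ :=
  ∫⁻ zω, hittingTime (guidedWalk (P.sweepWalk zω.1) zω.2) home ∂(P.law p)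

end SweepParams

/-! ### All the laws above are probability measures -/

instance (p : unitInterval) : IsProbabilityMeasure (stepNoiseLaw p) := by
  have : IsProbabilityMeasure (uniformOn (unitSteps : Set (ℤ × ℤ))) :=
    isProbabilityMeasure_uniformOn unitSteps.finite_toSet ⟨(1, 0), by simp [unitSteps]⟩
  unfold stepNoiseLaw
  infer_instance

instance (p : unitInterval) : IsProbabilityMeasure (noiseLaw p) := by
  unfold noiseLaw
  infer_instance

namespace SweepParams

variable (P : SweepParams)

theorem two_le_startTime (i : ℕ) : 2 ≤ P.startTime i := by
  induction i with
  | zero => exact le_rfl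
  | succ i ih => exact ih.trans (Nat.le_add_right _ _)

theorem one_le_M {t : ℕ} (ht : 1 ≤ t) : 1 ≤ P.M t := by
  have h : 0 < ⌈(t : ℝ) ^ (1 / 3 : ℝ)⌉₊ :=
    Nat.ceil_pos.2 (Real.rpow_pos_of_pos (by exact_mod_cast ht) _)
  unfold M
  omega

instance (i : ℕ) : IsProbabilityMeasure (uniformOn (Set.Icc 1 (P.M (P.startTime i)))) :=
  isProbabilityMeasure_uniformOn (Set.finite_Icc _ _)
    ⟨1, le_rfl, P.one_le_M (le_trans (by norm_num) (P.two_le_startTime i))⟩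

instance : IsProbabilityMeasure P.offsetLaw := by
  unfold offsetLaw
  infer_instance

instance (p : unitInterval) : IsProbabilityMeasure (P.law p) := by
  unfold law
  infer_instance

end SweepParams

/-! Follow the measure obtained from the law of the agent by killing it at `home`, at the times `t`
at which the phases start, and suppose that its mass is at most `C * t ^ (-h)`. In each of the four
directions `±x`, `±y`, let `σ ^ 2 * t` bound the variance accumulated up to time `t`, and keep the
exponential moment of `coordinate / (σ * √t)` at parameter `b / 2` below `exp (2 * h + b ^ 2 / 4)`
times the mass bound, up to a margin in `h`. By Markov's inequality, the agent is then in the box of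
half-sides `b * σ * √t` up to a fraction `4 * exp (2 * h - b ^ 2 / 4)` of the mass bound; the
parameter `b / 2` makes this fraction smallest.

Let the agent start a phase in that box, and let it make all `M` northward steps in a row; cutting
out those after the `z`-th one gives the phase with offset `z`. If all fluctuations are small, which
a Kolmogorov-type inequality makes likely, then some cut walk visits `home`. It does so when a point
of the column plus the displacement from the end of the column to a point of a horizontal line
equals `home`, that is, when the column meets the path of the points `home - displacement`; the two
are lattice paths that cross, so they have a common point. Hence a phase kills a fraction of about
`1 / M` of the mass in the box.

Since `duration * M` is about `4 * A * B / (1 - p₀) ^ 2 * t`, the total mass does decay like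
`t ^ (-h)` for some `h > 1` as soon as `4 * A * B / (1 - p₀) ^ 2 ≤ 1 - 4 * exp (2 - a ^ 2 / 4)` and
`p < p₀`: the latter makes `A` and `B` exceed `a * σ`, which leaves room for `b > a` and `h > 1`.
The survival probabilities are then summable. -/

/-! ### The constants `a` and `p₀` -/

/-- The function `g` of the paper: `p * √(3 - 2 * p) / (1 - p) ^ 2 ≤ gain b` is the constraint that
the choice of the parameter `b` of the sweep puts on the error probability `p`. -/
noncomputable def gain (b : ℝ) : ℝ := 1 / (2 * b ^ 2) * (1 - 4 * Real.exp (-b ^ 2 / 4 + 2))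

/-- The equation for the positive critical point of `gain`. -/
def IsGainCritical (a : ℝ) : Prop := Real.exp (a ^ 2 / 4 - 2) = 4 * (1 + a ^ 2 / 4)

theorem exp_lt_at_lower_bound :
    Real.exp ((4.566 : ℝ) ^ 2 / 4 - 2) < 4 * (1 + (4.566 : ℝ) ^ 2 / 4) := by
  have hsplit : Real.exp ((4.566 : ℝ) ^ 2 / 4 - 2) = Real.exp 1 ^ 3 * Real.exp 0.212089 := by
    rw [← Real.exp_nat_mul, ← Real.exp_add]; norm_num
  have hexp_one : Real.exp 1 ≤ 2.7182818286 := Real.exp_one_lt_d9.le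
  have hrest : Real.exp (0.212089 : ℝ) ≤ 1.237 :=
    (Real.exp_bound' (by norm_num) (by norm_num) (n := 4) (by norm_num)).trans
      (by norm_num [Finset.sum_range_succ, Nat.factorial])
  calc Real.exp ((4.566 : ℝ) ^ 2 / 4 - 2) ≤ (2.7182818286 : ℝ) ^ 3 * 1.237 := by
        rw [hsplit]; gcongr
    _ < 4 * (1 + (4.566 : ℝ) ^ 2 / 4) := by norm_num

theorem lt_exp_at_upper_bound :
    4 * (1 + (4.567 : ℝ) ^ 2 / 4) < Real.exp ((4.567 : ℝ) ^ 2 / 4 - 2) := by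
  have hsplit : Real.exp ((4.567 : ℝ) ^ 2 / 4 - 2) = Real.exp 1 ^ 3 * Real.exp 0.21437225 := by
    rw [← Real.exp_nat_mul, ← Real.exp_add]; norm_num
  have hexp_one : 2.7182818283 ≤ Real.exp 1 := Real.exp_one_gt_d9.le
  have hrest : 1.239 ≤ Real.exp (0.21437225 : ℝ) :=
    le_trans (by norm_num [Finset.sum_range_succ, Nat.factorial])
      (Real.sum_le_exp_of_nonneg (by norm_num) 5)
  calc 4 * (1 + (4.567 : ℝ) ^ 2 / 4) < (2.7182818283 : ℝ) ^ 3 * 1.239 := by norm_num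
    _ ≤ Real.exp ((4.567 : ℝ) ^ 2 / 4 - 2) := by rw [hsplit]; gcongr

theorem exists_isGainCritical : ∃ a : ℝ, (4.566 ≤ a ∧ a < 4.567) ∧ IsGainCritical a := by
  have hlow := exp_lt_at_lower_bound
  have hhigh := lt_exp_at_upper_bound
  have hcont : ContinuousOn (fun a : ℝ => Real.exp (a ^ 2 / 4 - 2) - 4 * (1 + a ^ 2 / 4))
      (Set.Icc 4.566 4.567) := by fun_prop
  obtain ⟨a, ⟨hle, hge⟩, ha⟩ := intermediate_value_Icc (by norm_num) hcont
    (show (0 : ℝ) ∈ Set.Icc _ _ from ⟨by linarith, by linarith⟩)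
  have hcrit : IsGainCritical a := sub_eq_zero.1 ha
  refine ⟨a, ⟨hle, hge.lt_of_ne ?_⟩, hcrit⟩
  rintro rfl
  exact hhigh.ne' hcrit

theorem gain_of_isGainCritical {a : ℝ} (ha : 0 < a) (h : IsGainCritical a) :
    gain a = 1 / (8 * (1 + a ^ 2 / 4)) := by
  have hexp : Real.exp (-a ^ 2 / 4 + 2) = (4 * (1 + a ^ 2 / 4))⁻¹ := by
    rw [← h, ← Real.exp_neg]; ring_nf
  rw [gain, hexp]
  field_simp
  ring

theorem isMaxOn_gain_of_isGainCritical {a : ℝ} (ha : 0 < a) (h : IsGainCritical a) :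
    IsMaxOn gain (Set.Ioi 0) a := by
  intro b (hb : 0 < b)
  rw [Set.mem_ofPred_eq, gain_of_isGainCritical ha h]
  -- the tangent line of the convex function `b² ↦ exp (-b² / 4 + 2)` at `a²`
  have htangent : (4 * (1 + a ^ 2 / 4))⁻¹ * (1 + a ^ 2 / 4 - b ^ 2 / 4)
      ≤ Real.exp (-b ^ 2 / 4 + 2) := by
    have hexp : Real.exp (-b ^ 2 / 4 + 2)
        = (4 * (1 + a ^ 2 / 4))⁻¹ * Real.exp (a ^ 2 / 4 - b ^ 2 / 4) := by
      rw [← h, ← Real.exp_neg, ← Real.exp_add]; ring_nf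
    rw [hexp]
    gcongr
    linarith [Real.add_one_le_exp (a ^ 2 / 4 - b ^ 2 / 4)]
  calc gain b
      ≤ 1 / (2 * b ^ 2) * (1 - 4 * ((4 * (1 + a ^ 2 / 4))⁻¹ * (1 + a ^ 2 / 4 - b ^ 2 / 4))) := by
        unfold gain; gcongr
    _ = 1 / (8 * (1 + a ^ 2 / 4)) := by field_simp; ring

theorem exists_threshold {a : ℝ} (ha1 : 4.566 ≤ a) (ha2 : a < 4.567) :
    ∃ p : ℝ, (0.01139 ≤ p ∧ p < 0.01140) ∧
      p * √(3 - 2 * p) / (1 - p) ^ 2 = 1 / (8 * (1 + a ^ 2 / 4)) := by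
  have : 0 ≤ a := by linarith
  have hlow : (0.01139 : ℝ) * √(3 - 2 * 0.01139) / (1 - 0.01139) ^ 2
      ≤ 1 / (8 * (1 + a ^ 2 / 4)) := by
    have hsqrt : √(3 - 2 * (0.01139 : ℝ)) ≤ 1.7255 :=
      (Real.sqrt_le_left (by norm_num)).2 (by norm_num)
    calc _ ≤ (0.01139 : ℝ) * 1.7255 / (1 - 0.01139) ^ 2 := by gcongr
      _ ≤ 1 / (8 * (1 + (4.567 : ℝ) ^ 2 / 4)) := by norm_num
      _ ≤ _ := by gcongr
  have hhigh : 1 / (8 * (1 + a ^ 2 / 4))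
      < (0.01140 : ℝ) * √(3 - 2 * 0.01140) / (1 - 0.01140) ^ 2 := by
    have hsqrt : 1.7254 ≤ √(3 - 2 * (0.01140 : ℝ)) := Real.le_sqrt_of_sq_le (by norm_num)
    calc _ ≤ 1 / (8 * (1 + (4.566 : ℝ) ^ 2 / 4)) := by gcongr
      _ < (0.01140 : ℝ) * 1.7254 / (1 - 0.01140) ^ 2 := by norm_num
      _ ≤ _ := by gcongr
  have hcont : ContinuousOn (fun p : ℝ => p * √(3 - 2 * p) / (1 - p) ^ 2)
      (Set.Icc 0.01139 0.01140) := by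
    refine ContinuousOn.div (by fun_prop) (by fun_prop) fun p hp => pow_ne_zero 2 ?_
    norm_num at hp
    linarith [hp.2]
  obtain ⟨p, ⟨hp1, hp2⟩, hp⟩ := intermediate_value_Icc (by norm_num) hcont
    (show 1 / (8 * (1 + a ^ 2 / 4)) ∈ Set.Icc _ _ from ⟨hlow, hhigh.le⟩)
  refine ⟨p, ⟨hp1, hp2.lt_of_ne ?_⟩, hp⟩
  rintro rfl
  exact hhigh.ne' hp

/-! ### Crossing paths in `ℤ²` -/

/-- The edge from `u` to `v` crosses the ray `(0, ∞) × {1 / 2}`. -/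
def crossesRay (u v : ℤ × ℤ) : ZMod 2 :=
  if 0 < u.1 ∧ u.1 = v.1 ∧ ((u.2 = 0 ∧ v.2 = 1) ∨ (u.2 = 1 ∧ v.2 = 0)) then 1 else 0

theorem crossesRay_square {v a b : ℤ × ℤ} (ha : a ∈ unitSteps) (hb : b ∈ unitSteps)
    (h0 : v ≠ 0) (h1 : v + a ≠ 0) (h2 : v + b ≠ 0) (h3 : v + a + b ≠ 0) :
    crossesRay v (v + a) + crossesRay (v + a) (v + a + b)
      = crossesRay v (v + b) + crossesRay (v + b) (v + a + b) := by
  obtain ⟨x, y⟩ := v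
  simp only [unitSteps, Finset.mem_insert, Finset.mem_singleton] at ha hb
  rcases ha with rfl | rfl | rfl | rfl <;> rcases hb with rfl | rfl | rfl | rfl <;>
    simp only [crossesRay, ne_eq, Prod.ext_iff, Prod.fst_add, Prod.snd_add, Prod.fst_zero,
      Prod.snd_zero] at * <;>
    split_ifs <;> first | rfl | (exfalso; omega)

/-- The parity of the number of crossings of the ray along the first `n` edges of a path. It is
invariant under homotopies that avoid the origin. -/
def rayParity (f : ℕ → ℤ × ℤ) (n : ℕ) : ZMod 2 :=
  ∑ i ∈ Finset.range n, crossesRay (f i) (f (i + 1))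

theorem rayParity_zero (f : ℕ → ℤ × ℤ) : rayParity f 0 = 0 := rfl

theorem rayParity_succ (f : ℕ → ℤ × ℤ) (n : ℕ) :
    rayParity f (n + 1) = rayParity f n + crossesRay (f n) (f (n + 1)) :=
  Finset.sum_range_succ _ n

theorem rayParity_eq_zero {f : ℕ → ℤ × ℤ} {n : ℕ}
    (h : ∀ i ≤ n, (f i).1 ≤ 0 ∨ (f i).2 ≤ -1 ∨ 2 ≤ (f i).2) : rayParity f n = 0 := by
  refine Finset.sum_eq_zero fun i hi => ?_
  have := h i (Finset.mem_range.1 hi).le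
  rw [crossesRay, if_neg]
  omega

theorem rayParity_of_pos {f : ℕ → ℤ × ℤ} {n : ℕ} (hx : ∀ i ≤ n, 0 < (f i).1)
    (hs : ∀ i < n, f (i + 1) - f i ∈ unitSteps) (h0 : (f 0).2 ≤ 0) :
    rayParity f n = if 0 < (f n).2 then 1 else 0 := by
  induction n with
  | zero => simp [rayParity_zero, h0.not_gt]
  | succ n ih =>
    rw [rayParity_succ, ih (fun i hi => hx i (by omega)) (fun i hi => hs i (by omega))]
    have hstep := hs n (by omega)
    have hpos := hx n (by omega)
    simp only [unitSteps, Finset.mem_insert, Finset.mem_singleton, Prod.ext_iff, Prod.fst_sub,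
      Prod.snd_sub] at hstep
    rw [crossesRay]
    split_ifs <;> first | rfl | (exfalso; omega)

theorem rayParity_strip {f g : ℕ → ℤ × ℤ} {n : ℕ} (hf : ∀ j ≤ n, f j ≠ 0) (hg : ∀ j ≤ n, g j ≠ 0)
    (hsq : ∀ j < n, ∃ a ∈ unitSteps, ∃ b ∈ unitSteps,
      g j = f j + a ∧ f (j + 1) = f j + b ∧ g (j + 1) = f j + a + b) :
    crossesRay (f 0) (g 0) + rayParity g n = rayParity f n + crossesRay (f n) (g n) := by
  induction n with
  | zero => simp [rayParity_zero]
  | succ n ih =>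
    have ih := ih (fun j hj => hf j (by omega)) (fun j hj => hg j (by omega))
      (fun j hj => hsq j (by omega))
    obtain ⟨a, ha, b, hb, hga, hfb, hgab⟩ := hsq n (by omega)
    have hsquare : crossesRay (f n) (g n) + crossesRay (g n) (g (n + 1))
        = crossesRay (f n) (f (n + 1)) + crossesRay (f (n + 1)) (g (n + 1)) := by
      have h1 := hg n (by omega)
      have h2 := hf (n + 1) le_rfl
      have h3 := hg (n + 1) le_rfl
      rw [hga] at h1 ⊢
      rw [hfb] at h2 ⊢
      rw [hgab] at h3 ⊢
      exact crossesRay_square ha hb (hf n (by omega)) h1 h2 h3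
    rw [rayParity_succ, rayParity_succ, ← add_assoc, ih, add_assoc, hsquare, ← add_assoc]

theorem rayParity_homotopy {D : ℕ → ℕ → ℤ × ℤ} {m n : ℕ}
    (hne : ∀ i ≤ m, ∀ j ≤ n, D i j ≠ 0)
    (hsq : ∀ i < m, ∀ j < n, ∃ a ∈ unitSteps, ∃ b ∈ unitSteps, D (i + 1) j = D i j + a ∧
      D i (j + 1) = D i j + b ∧ D (i + 1) (j + 1) = D i j + a + b) :
    rayParity (fun i => D i 0) m + rayParity (D m) n
      = rayParity (D 0) n + rayParity (fun i => D i n) m := by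
  induction m with
  | zero => simp [rayParity_zero]
  | succ m ih =>
    have ih := ih (fun i hi => hne i (by omega)) (fun i hi => hsq i (by omega))
    have hstrip := rayParity_strip (hne m (by omega)) (hne (m + 1) le_rfl) (hsq m (by omega))
    rw [rayParity_succ, rayParity_succ, add_assoc, hstrip, ← add_assoc, ih, add_assoc]

theorem exists_common_point {S Q : ℕ → ℤ × ℤ} {m n : ℕ}
    (hS : ∀ i < m, S (i + 1) - S i ∈ unitSteps) (hQ : ∀ j < n, Q (j + 1) - Q j ∈ unitSteps)
    (hleft : ∀ i ≤ m, (Q 0).1 < (S i).1) (hright : ∀ i ≤ m, (S i).1 < (Q n).1)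
    (hbot : ∀ j ≤ n, (S 0).2 < (Q j).2) (htop : ∀ j ≤ n, (Q j).2 + 1 < (S m).2) :
    ∃ i ≤ m, ∃ j ≤ n, S i = Q j := by
  by_contra! hne
  have hneg : ∀ s ∈ unitSteps, -s ∈ unitSteps := by decide
  -- the boundary of the homotopy `S i - Q j`, which avoids the origin, winds once around it
  have hparity := rayParity_homotopy (D := fun i j => S i - Q j) (m := m) (n := n)
    (fun i hi j hj => sub_ne_zero.2 (hne i hi j hj))
    (fun i hi j hj => ⟨_, hS i hi, _, hneg _ (hQ j hj), by abel, by abel, by abel⟩)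
  have hb := hbot 0 (by omega)
  have ht := htop 0 (by omega)
  have hfirst : rayParity (fun i => S i - Q 0) m = 1 := by
    rw [rayParity_of_pos, if_pos]
    · simp only [Prod.snd_sub]; omega
    · intro i hi; have := hleft i hi; simp only [Prod.fst_sub]; omega
    · intro i hi; simpa using hS i hi
    · simp only [Prod.snd_sub]; omega
  have hlast : rayParity (fun i => S i - Q n) m = 0 := rayParity_eq_zero fun i hi => by
    have := hright i hi; simp only [Prod.fst_sub]; omega
  have hstart : rayParity (fun j => S 0 - Q j) n = 0 := rayParity_eq_zero fun j hj => by
    have := hbot j hj; simp only [Prod.snd_sub]; omega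
  have hend : rayParity (fun j => S m - Q j) n = 0 := rayParity_eq_zero fun j hj => by
    have := htop j hj; simp only [Prod.snd_sub]; omega
  rw [hfirst, hlast, hstart, hend] at hparity
  exact absurd hparity (by decide)

/-! ### Expectations over the steps of an agent that is given a list of instructions -/

/-- The expectation of a function of the step made by an agent with error probability `p` who is
given the instruction `d`. -/
noncomputable def stepMean (p : ℝ) (d : ℤ × ℤ) : (ℤ × ℤ → ℝ) →ₗ[ℝ] ℝ :=
  (1 - p) • LinearMap.proj d + (p / 4) • ∑ s ∈ unitSteps, LinearMap.proj s

/-- The expectation of a function of the list of steps made by an agent with error probability `p`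
who is given the instructions `l`. -/
noncomputable def stepsMean (p : ℝ) : List (ℤ × ℤ) → (List (ℤ × ℤ) → ℝ) →ₗ[ℝ] ℝ
  | [] => LinearMap.proj []
  | d :: l => stepMean p d ∘ₗ
      LinearMap.pi fun s => stepsMean p l ∘ₗ LinearMap.funLeft ℝ ℝ (List.cons s)

/-- The probability that the list of steps made by an agent with error probability `p` who is given
the instructions `l` belongs to `E`. -/
noncomputable def stepsProb (p : ℝ) (l : List (ℤ × ℤ)) (E : Set (List (ℤ × ℤ))) : ℝ :=
  stepsMean p l (E.indicator 1)

theorem card_unitSteps : unitSteps.card = 4 := rfl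

section Expectation

variable {p : ℝ}

theorem stepMean_apply (d : ℤ × ℤ) (f : ℤ × ℤ → ℝ) :
    stepMean p d f = (1 - p) * f d + p / 4 * ∑ s ∈ unitSteps, f s := by
  simp [stepMean, LinearMap.sum_apply]

theorem stepMean_const (d : ℤ × ℤ) (r : ℝ) : stepMean p d (fun _ => r) = r := by
  rw [stepMean_apply, Finset.sum_const, card_unitSteps, nsmul_eq_mul]
  push_cast
  ring

theorem stepMean_add (d : ℤ × ℤ) (f g : ℤ × ℤ → ℝ) :
    stepMean p d (fun s => f s + g s) = stepMean p d f + stepMean p d g :=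
  (stepMean p d).map_add f g

theorem stepMean_mul_const (d : ℤ × ℤ) (f : ℤ × ℤ → ℝ) (r : ℝ) :
    stepMean p d (fun s => f s * r) = stepMean p d f * r := by
  simp only [stepMean_apply, ← Finset.sum_mul]
  ring

theorem stepMean_mono (hp : p ∈ Set.Icc (0 : ℝ) 1) (d : ℤ × ℤ) : Monotone (stepMean p d) := by
  intro f g hfg
  have h0 : 0 ≤ p := hp.1
  have h1 : 0 ≤ 1 - p := sub_nonneg.2 hp.2
  simp only [stepMean_apply]
  gcongr <;> exact hfg _

theorem stepMean_le_of_unitSteps (hp : p ∈ Set.Icc (0 : ℝ) 1) {d : ℤ × ℤ} (hd : d ∈ unitSteps)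
    {f g : ℤ × ℤ → ℝ} (h : ∀ s ∈ unitSteps, f s ≤ g s) : stepMean p d f ≤ stepMean p d g := by
  have h0 : 0 ≤ p := hp.1
  have h1 : 0 ≤ 1 - p := sub_nonneg.2 hp.2
  simp only [stepMean_apply]
  gcongr with s hs
  exacts [h d hd, h s hs]

@[simp]
theorem stepsMean_nil (Φ : List (ℤ × ℤ) → ℝ) : stepsMean p [] Φ = Φ [] := rfl

theorem stepsMean_cons (d : ℤ × ℤ) (l : List (ℤ × ℤ)) (Φ : List (ℤ × ℤ) → ℝ) :
    stepsMean p (d :: l) Φ = stepMean p d fun s => stepsMean p l fun a => Φ (s :: a) := rfl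

theorem stepsMean_const (l : List (ℤ × ℤ)) (r : ℝ) : stepsMean p l (fun _ => r) = r := by
  induction l with
  | nil => rfl
  | cons d l ih => simp only [stepsMean_cons, ih, stepMean_const]

theorem stepsMean_append (l₁ l₂ : List (ℤ × ℤ)) (Φ : List (ℤ × ℤ) → ℝ) :
    stepsMean p (l₁ ++ l₂) Φ
      = stepsMean p l₁ (fun a => stepsMean p l₂ (fun b => Φ (a ++ b))) := by
  induction l₁ generalizing Φ with
  | nil => rfl
  | cons d l ih => simp only [List.cons_append, stepsMean_cons, ih]

theorem stepsMean_const_mul (l : List (ℤ × ℤ)) (r : ℝ) (Φ : List (ℤ × ℤ) → ℝ) :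
    stepsMean p l (fun a => r * Φ a) = r * stepsMean p l Φ :=
  (stepsMean p l).map_smul r Φ

theorem stepsMean_add (l : List (ℤ × ℤ)) (Φ Ψ : List (ℤ × ℤ) → ℝ) :
    stepsMean p l (fun a => Φ a + Ψ a) = stepsMean p l Φ + stepsMean p l Ψ :=
  (stepsMean p l).map_add Φ Ψ

theorem stepsMean_mono (hp : p ∈ Set.Icc (0 : ℝ) 1) (l : List (ℤ × ℤ)) :
    Monotone (stepsMean p l) := by
  induction l with
  | nil => exact fun _ _ h => h []
  | cons d l ih => exact fun _ _ h => stepMean_mono hp d fun s => ih fun a => h (s :: a)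

theorem stepsMean_le_of_unitSteps (hp : p ∈ Set.Icc (0 : ℝ) 1) {l : List (ℤ × ℤ)}
    (hl : ∀ d ∈ l, d ∈ unitSteps) {Φ Ψ : List (ℤ × ℤ) → ℝ}
    (h : ∀ a, a.length = l.length → (∀ s ∈ a, s ∈ unitSteps) → Φ a ≤ Ψ a) :
    stepsMean p l Φ ≤ stepsMean p l Ψ := by
  induction l generalizing Φ Ψ with
  | nil => exact h [] rfl (by simp)
  | cons d l ih =>
    rw [List.forall_mem_cons] at hl
    exact stepMean_le_of_unitSteps hp hl.1 fun s hs => ih hl.2 fun a ha hu =>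
      h _ (by simp [ha]) (List.forall_mem_cons.2 ⟨hs, hu⟩)

theorem stepsMean_take {l : List (ℤ × ℤ)} {n : ℕ} (hn : n ≤ l.length)
    (Φ : List (ℤ × ℤ) → ℝ) :
    stepsMean p (l.take n) Φ = stepsMean p l (fun a => Φ (a.take n)) := by
  induction l generalizing n Φ with
  | nil => simp
  | cons d l ih =>
    cases n with
    | zero => simp [stepsMean_const]
    | succ n =>
      simp only [List.length_cons, add_le_add_iff_right] at hn
      simp only [List.take_succ_cons, stepsMean_cons, ih hn]

theorem stepsProb_cons (d : ℤ × ℤ) (l : List (ℤ × ℤ)) (E : Set (List (ℤ × ℤ))) :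
    stepsProb p (d :: l) E = stepMean p d fun s => stepsProb p l {a | s :: a ∈ E} := rfl

theorem stepsProb_le_one (hp : p ∈ Set.Icc (0 : ℝ) 1) (l : List (ℤ × ℤ))
    (E : Set (List (ℤ × ℤ))) : stepsProb p l E ≤ 1 :=
  (stepsMean_mono hp l fun _ => Set.indicator_le_self' (fun _ _ => zero_le_one) _).trans_eq
    (stepsMean_const l 1)

theorem stepsProb_mono (hp : p ∈ Set.Icc (0 : ℝ) 1) (l : List (ℤ × ℤ)) :
    Monotone (stepsProb p l) := fun _ _ h =>
  stepsMean_mono hp l (Set.indicator_le_indicator_of_subset h fun _ => zero_le_one)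

theorem stepsProb_union_le (hp : p ∈ Set.Icc (0 : ℝ) 1) (l : List (ℤ × ℤ))
    (E F : Set (List (ℤ × ℤ))) : stepsProb p l (E ∪ F) ≤ stepsProb p l E + stepsProb p l F := by
  rw [stepsProb, stepsProb, stepsProb, ← map_add]
  refine stepsMean_mono hp l fun a => ?_
  by_cases hE : a ∈ E <;> by_cases hF : a ∈ F <;> simp [hE, hF]

theorem stepsProb_biUnion_le (hp : p ∈ Set.Icc (0 : ℝ) 1) (l : List (ℤ × ℤ)) {ι : Type*}
    (s : Finset ι) (E : ι → Set (List (ℤ × ℤ))) :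
    stepsProb p l (⋃ i ∈ s, E i) ≤ ∑ i ∈ s, stepsProb p l (E i) := by
  classical
  induction s using Finset.induction_on with
  | empty => simpa [stepsProb] using (stepsMean_const l 0).le
  | insert i s hi ih =>
    rw [Finset.set_biUnion_insert, Finset.sum_insert hi]
    grw [stepsProb_union_le hp, ih]

theorem one_le_stepsProb_of_unitSteps (hp : p ∈ Set.Icc (0 : ℝ) 1) {l : List (ℤ × ℤ)}
    (hl : ∀ d ∈ l, d ∈ unitSteps) {E : Set (List (ℤ × ℤ))}
    (h : ∀ a, a.length = l.length → (∀ s ∈ a, s ∈ unitSteps) → a ∈ E) : 1 ≤ stepsProb p l E :=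
  (stepsMean_const l 1).symm.trans_le <| stepsMean_le_of_unitSteps hp hl fun a ha hu =>
    (Set.indicator_of_mem (h a ha hu) (fun _ => (1 : ℝ))).ge

end Expectation

/-! ### Coordinates, fluctuations and exponential moments -/

/-- The properties of the two coordinates, and of their negatives, that matter for the moments of
a step. -/
structure IsCoordinate (c : ℤ × ℤ →+ ℝ) : Prop where
  sum_eq : ∑ s ∈ unitSteps, c s = 0
  sum_sq_eq : ∑ s ∈ unitSteps, c s ^ 2 = 2
  abs_le : ∀ s ∈ unitSteps, |c s| ≤ 1

/-- The first coordinate as a real number. -/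
def fstCoord : ℤ × ℤ →+ ℝ := (Int.castAddHom ℝ).comp (AddMonoidHom.fst ℤ ℤ)

/-- The second coordinate as a real number. -/
def sndCoord : ℤ × ℤ →+ ℝ := (Int.castAddHom ℝ).comp (AddMonoidHom.snd ℤ ℤ)

@[simp] theorem fstCoord_apply (x : ℤ × ℤ) : fstCoord x = x.1 := rfl

@[simp] theorem sndCoord_apply (x : ℤ × ℤ) : sndCoord x = x.2 := rfl

theorem sum_unitSteps (f : ℤ × ℤ → ℝ) :
    ∑ s ∈ unitSteps, f s = f (1, 0) + f (-1, 0) + f (0, 1) + f (0, -1) := by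
  rw [unitSteps, Finset.sum_insert (by decide), Finset.sum_insert (by decide),
    Finset.sum_insert (by decide), Finset.sum_singleton]
  ring

theorem isCoordinate_fstCoord : IsCoordinate fstCoord where
  sum_eq := by rw [sum_unitSteps]; simp
  sum_sq_eq := by rw [sum_unitSteps]; norm_num
  abs_le := by simp [unitSteps]

theorem isCoordinate_sndCoord : IsCoordinate sndCoord where
  sum_eq := by rw [sum_unitSteps]; simp
  sum_sq_eq := by rw [sum_unitSteps]; norm_num
  abs_le := by simp [unitSteps]

theorem IsCoordinate.neg {c : ℤ × ℤ →+ ℝ} (hc : IsCoordinate c) : IsCoordinate (-c) where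
  sum_eq := by simp [hc.sum_eq]
  sum_sq_eq := by simp [hc.sum_sq_eq]
  abs_le := by simpa using hc.abs_le

/-- The variance of a coordinate of the step of an agent with error probability `p` whose
instruction has the coordinate `u`. -/
noncomputable def stepVar (p u : ℝ) : ℝ := p / 2 + p * (1 - p) * u ^ 2

/-- The deviation from its mean of the coordinate `c` after the first `k` of the steps `a`, for
the instructions `l`. -/
noncomputable def fluctuation (p : ℝ) (c : ℤ × ℤ →+ ℝ) (l a : List (ℤ × ℤ)) (k : ℕ) : ℝ :=
  c (a.take k).sum - (1 - p) * c (l.take k).sum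

section Moments

variable {p : ℝ} {c : ℤ × ℤ →+ ℝ}

theorem stepVar_le_one (hp : p ∈ Set.Icc (0 : ℝ) 1) {u : ℝ} (hu : |u| ≤ 1) : stepVar p u ≤ 1 := by
  have hu2 : u ^ 2 ≤ 1 := (sq_le_one_iff_abs_le_one u).2 hu
  have hvar : p * (1 - p) * u ^ 2 ≤ p * (1 - p) :=
    mul_le_of_le_one_right (mul_nonneg hp.1 (sub_nonneg.2 hp.2)) hu2
  unfold stepVar
  nlinarith [sq_nonneg (p - 3 / 4)]

theorem IsCoordinate.stepMean_sub (hc : IsCoordinate c) (d : ℤ × ℤ) :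
    stepMean p d (fun s => c s - (1 - p) * c d) = 0 := by
  rw [stepMean_apply, Finset.sum_sub_distrib, hc.sum_eq, Finset.sum_const, card_unitSteps,
    nsmul_eq_mul]
  push_cast
  ring

theorem IsCoordinate.stepMean_sq (hc : IsCoordinate c) (d : ℤ × ℤ) (x : ℝ) :
    stepMean p d (fun s => (x + (c s - (1 - p) * c d)) ^ 2) = x ^ 2 + stepVar p (c d) := by
  have hexpand : ∀ s, (x + (c s - (1 - p) * c d)) ^ 2
      = (x - (1 - p) * c d) ^ 2 + 2 * (x - (1 - p) * c d) * c s + c s ^ 2 := fun s => by ring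
  simp only [stepMean_apply, hexpand, Finset.sum_add_distrib, ← Finset.mul_sum, hc.sum_eq,
    hc.sum_sq_eq, Finset.sum_const, card_unitSteps, nsmul_eq_mul, stepVar]
  push_cast
  ring

theorem fluctuation_zero (l a : List (ℤ × ℤ)) : fluctuation p c l a 0 = 0 := by
  simp [fluctuation]

theorem fluctuation_cons_succ (d s : ℤ × ℤ) (l a : List (ℤ × ℤ)) (k : ℕ) :
    fluctuation p c (d :: l) (s :: a) (k + 1)
      = (c s - (1 - p) * c d) + fluctuation p c l a k := by
  simp only [fluctuation, List.take_succ_cons, List.sum_cons, map_add]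
  ring

theorem exists_le_abs_add_fluctuation_cons {δ x : ℝ} (hx : ¬ δ ≤ |x|) (d s : ℤ × ℤ)
    (l a : List (ℤ × ℤ)) :
    (∃ k ≤ (d :: l).length, δ ≤ |x + fluctuation p c (d :: l) (s :: a) k|) ↔
      ∃ k ≤ l.length, δ ≤ |x + (c s - (1 - p) * c d) + fluctuation p c l a k| := by
  refine ⟨?_, fun ⟨k, hk, h⟩ =>
    ⟨k + 1, by simpa using hk, by rwa [fluctuation_cons_succ, ← add_assoc]⟩⟩
  rintro ⟨_ | k, hk, h⟩
  · exact absurd (by simpa [fluctuation_zero] using h) hx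
  · exact ⟨k, by simpa using hk, by rwa [fluctuation_cons_succ, ← add_assoc] at h⟩

theorem stepsProb_le_of_le_abs (hp : p ∈ Set.Icc (0 : ℝ) 1) {δ x : ℝ} (hδ : 0 < δ)
    (hx : δ ≤ |x|) (l : List (ℤ × ℤ)) (E : Set (List (ℤ × ℤ))) (n : ℕ) :
    stepsProb p l E ≤ (x ^ 2 + n) / δ ^ 2 := by
  have hsq : δ ^ 2 ≤ x ^ 2 := sq_le_sq.2 (by rwa [abs_of_pos hδ])
  refine (stepsProb_le_one hp l E).trans ((one_le_div (by positivity)).2 ?_)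
  linarith [(Nat.cast_nonneg n : (0 : ℝ) ≤ n)]

theorem stepsProb_fluctuation_le (hp : p ∈ Set.Icc (0 : ℝ) 1) (hc : IsCoordinate c)
    {δ : ℝ} (hδ : 0 < δ) {l : List (ℤ × ℤ)} (hl : ∀ d ∈ l, d ∈ unitSteps) (x : ℝ) :
    stepsProb p l {a | ∃ k ≤ l.length, δ ≤ |x + fluctuation p c l a k|}
      ≤ (x ^ 2 + l.length) / δ ^ 2 := by
  induction l generalizing x with
  | nil =>
    by_cases hx : δ ≤ |x|
    · exact stepsProb_le_of_le_abs hp hδ hx _ _ _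
    · simpa [stepsProb, fluctuation_zero, hx] using by positivity
  | cons d l ih =>
    by_cases hx : δ ≤ |x|
    · exact stepsProb_le_of_le_abs hp hδ hx _ _ _
    rw [List.forall_mem_cons] at hl
    have hvar := stepVar_le_one hp (hc.abs_le d hl.1)
    rw [stepsProb_cons]
    simp only [Set.mem_ofPred_eq, exists_le_abs_add_fluctuation_cons hx]
    calc _ ≤ stepMean p d
            (fun s => ((x + (c s - (1 - p) * c d)) ^ 2 + l.length) * (δ ^ 2)⁻¹) :=
          stepMean_mono hp d fun s => ih hl.2 _
      _ = (x ^ 2 + stepVar p (c d) + l.length) * (δ ^ 2)⁻¹ := by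
          rw [stepMean_mul_const, stepMean_add, stepMean_const, hc.stepMean_sq]
      _ ≤ (x ^ 2 + (d :: l).length) / δ ^ 2 := by
          rw [List.length_cons, div_eq_mul_inv]
          push_cast
          gcongr ?_ * _
          linarith

theorem stepsMean_exp_le (hp : p ∈ Set.Icc (0 : ℝ) 1) {r : ℝ} {v : ℤ × ℤ → ℝ}
    {l : List (ℤ × ℤ)} (h : ∀ d ∈ l, stepMean p d (fun s => Real.exp (r * c s))
      ≤ Real.exp (r * ((1 - p) * c d) + r ^ 2 / 2 * v d)) :
    stepsMean p l (fun a => Real.exp (r * c a.sum))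
      ≤ Real.exp (r * ((1 - p) * c l.sum) + r ^ 2 / 2 * (l.map v).sum) := by
  induction l with
  | nil => simp
  | cons d l ih =>
    rw [List.forall_mem_cons] at h
    have hfactor : stepsMean p (d :: l) (fun a => Real.exp (r * c a.sum))
        = stepMean p d (fun s => Real.exp (r * c s)) *
            stepsMean p l (fun a => Real.exp (r * c a.sum)) := by
      simp only [stepsMean_cons, List.sum_cons, map_add, mul_add, Real.exp_add,
        stepsMean_const_mul, stepMean_mul_const]
    have hnonneg : 0 ≤ stepsMean p l (fun a => Real.exp (r * c a.sum)) :=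
      (stepsMean_const l 0).symm.trans_le (stepsMean_mono hp l fun _ => (Real.exp_pos _).le)
    calc _ ≤ Real.exp (r * ((1 - p) * c d) + r ^ 2 / 2 * v d) *
          Real.exp (r * ((1 - p) * c l.sum) + r ^ 2 / 2 * (l.map v).sum) := by
          rw [hfactor]
          exact mul_le_mul h.1 (ih h.2) hnonneg (Real.exp_pos _).le
      _ = _ := by
          rw [← Real.exp_add]
          simp only [List.sum_cons, map_add, List.map_cons]
          ring_nf

theorem exp_le_quadratic_add_cube {u : ℝ} (hu : |u| ≤ 1) :
    Real.exp u ≤ 1 + u + u ^ 2 / 2 + |u| ^ 3 := by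
  have hbound := (abs_le.1 (Real.exp_bound hu (n := 3) (by norm_num))).2
  norm_num [Finset.sum_range_succ, Nat.factorial] at hbound
  have hcube : 0 ≤ |u| ^ 3 := by positivity
  linarith

theorem exp_mul_le_taylor_of_abs_sub_le {r u m : ℝ} (hu : |u - m| ≤ 2) (hr : |r| ≤ 1 / 2) :
    Real.exp (r * u) ≤ (1 + r * (u - m) + r ^ 2 / 2 * (u - m) ^ 2 + 8 * |r| ^ 3) *
      Real.exp (r * m) := by
  have hru : |r * (u - m)| ≤ 2 * |r| := by
    rw [abs_mul]; nlinarith [abs_nonneg r]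
  have hcube : |r * (u - m)| ^ 3 ≤ 8 * |r| ^ 3 :=
    (pow_le_pow_left₀ (abs_nonneg _) hru 3).trans_eq (by ring)
  have htaylor := exp_le_quadratic_add_cube (hru.trans (by linarith))
  have hsplit : Real.exp (r * u) = Real.exp (r * (u - m)) * Real.exp (r * m) := by
    rw [← Real.exp_add]; ring_nf
  rw [hsplit]
  gcongr
  linarith [mul_pow r (u - m) 2]

theorem stepMean_exp_le_taylor (hp : p ∈ Set.Icc (0 : ℝ) 1) (hc : IsCoordinate c) {d : ℤ × ℤ}
    (hd : d ∈ unitSteps) {r : ℝ} (hr : |r| ≤ 1 / 2) :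
    stepMean p d (fun s => Real.exp (r * c s))
      ≤ (1 + r ^ 2 / 2 * stepVar p (c d) + 8 * |r| ^ 3) * Real.exp (r * ((1 - p) * c d)) := by
  have hm : |(1 - p) * c d| ≤ 1 := by
    rw [abs_mul, abs_of_nonneg (sub_nonneg.2 hp.2)]
    exact mul_le_one₀ (by linarith [hp.1]) (abs_nonneg _) (hc.abs_le d hd)
  have hstep (s : ℤ × ℤ) (hs : s ∈ unitSteps) := exp_mul_le_taylor_of_abs_sub_le (r := r)
    (u := c s) (m := (1 - p) * c d) ((abs_sub _ _).trans (by linarith [hc.abs_le s hs])) hr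
  refine (stepMean_le_of_unitSteps hp hd hstep).trans_eq ?_
  have hsq := hc.stepMean_sq (p := p) d 0
  have hmean := hc.stepMean_sub (p := p) d
  rw [stepMean_mul_const]
  simp only [stepMean_apply, zero_add] at hsq hmean ⊢
  simp only [Finset.sum_add_distrib, ← Finset.mul_sum, Finset.sum_const, card_unitSteps,
    nsmul_eq_mul]
  push_cast
  linear_combination (r ^ 2 / 2 * hsq + r * hmean) * Real.exp (r * ((1 - p) * c d))

theorem eventually_forall_stepMean_exp_le (hp : p ∈ Set.Icc (0 : ℝ) 1) (hc : IsCoordinate c)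
    {v : ℤ × ℤ → ℝ} (hv : ∀ d ∈ unitSteps, stepVar p (c d) < v d) :
    ∀ᶠ r : ℝ in nhds 0, ∀ d ∈ unitSteps, stepMean p d (fun s => Real.exp (r * c s))
      ≤ Real.exp (r * ((1 - p) * c d) + r ^ 2 / 2 * v d) := by
  rw [Finset.eventually_all]
  intro d hd
  have hsmall (ε : ℝ) (hε : 0 < ε) : ∀ᶠ r : ℝ in nhds 0, |r| < ε :=
    (continuous_abs.tendsto' 0 0 abs_zero).eventually_lt_const hε
  filter_upwards [hsmall (1 / 2) (by norm_num),
    hsmall ((v d - stepVar p (c d)) / 16) (by linarith [hv d hd])] with r hr hrv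
  have hcube : |r| ^ 3 = r ^ 2 * |r| := by rw [← sq_abs]; ring
  rw [add_comm, Real.exp_add]
  refine (stepMean_exp_le_taylor hp hc hd hr.le).trans ?_
  gcongr
  refine le_trans ?_ (Real.add_one_le_exp _)
  rw [hcube]
  nlinarith [sq_nonneg r]

end Moments

/-! ### Walks that have not yet visited their home -/

/-- The indicator of the event that the walk with start `x` and steps `a` does not visit `home`
after its start. -/
def aliveInd (home : ℤ × ℤ) : ℤ × ℤ → List (ℤ × ℤ) → ℝ
  | _, [] => 1
  | x, s :: a => if x + s = home then 0 else aliveInd home (x + s) a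

section Survival

variable {p : ℝ} {home : ℤ × ℤ}

theorem aliveInd_nonneg (x : ℤ × ℤ) (a : List (ℤ × ℤ)) : 0 ≤ aliveInd home x a := by
  induction a generalizing x with
  | nil => exact zero_le_one
  | cons s a ih => rw [aliveInd]; split_ifs; exacts [le_rfl, ih _]

theorem aliveInd_le_one (x : ℤ × ℤ) (a : List (ℤ × ℤ)) : aliveInd home x a ≤ 1 := by
  induction a generalizing x with
  | nil => exact le_rfl
  | cons s a ih => rw [aliveInd]; split_ifs; exacts [zero_le_one, ih _]

theorem aliveInd_append (x : ℤ × ℤ) (a b : List (ℤ × ℤ)) :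
    aliveInd home x (a ++ b) = aliveInd home x a * aliveInd home (x + a.sum) b := by
  induction a generalizing x with
  | nil => simp [aliveInd]
  | cons s a ih =>
    simp only [List.cons_append, aliveInd, ih, List.sum_cons, add_assoc]
    split_ifs <;> simp

theorem aliveInd_append_eq_zero {x : ℤ × ℤ} {a : List (ℤ × ℤ)} (ha : a ≠ [])
    (h : x + a.sum = home) (b : List (ℤ × ℤ)) : aliveInd home x (a ++ b) = 0 := by
  obtain ⟨a', s, rfl⟩ := List.eq_nil_or_concat' a |>.resolve_left ha
  simp only [List.sum_append, List.sum_cons, List.sum_nil, add_zero, ← add_assoc] at h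
  simp [aliveInd_append, aliveInd, h]

/-- The expectation of a function of the final position of the agent on the event that the agent,
starting at `x` and given the instructions `l`, does not visit `home` after its start. -/
noncomputable def survOp (p : ℝ) (home : ℤ × ℤ) (l : List (ℤ × ℤ)) :
    (ℤ × ℤ → ℝ) →ₗ[ℝ] (ℤ × ℤ → ℝ) where
  toFun f x := stepsMean p l fun a => aliveInd home x a * f (x + a.sum)
  map_add' f g := by
    ext x
    simp only [Pi.add_apply, mul_add, stepsMean_add]
  map_smul' r f := by
    ext x
    simp only [Pi.smul_apply, smul_eq_mul, RingHom.id_apply, mul_left_comm _ r,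
      stepsMean_const_mul]

theorem survOp_apply (l : List (ℤ × ℤ)) (f : ℤ × ℤ → ℝ) (x : ℤ × ℤ) :
    survOp p home l f x = stepsMean p l fun a => aliveInd home x a * f (x + a.sum) := rfl

theorem survOp_nil (f : ℤ × ℤ → ℝ) : survOp p home [] f = f := by
  ext x; simp [survOp_apply, aliveInd]

theorem survOp_singleton (d : ℤ × ℤ) (f : ℤ × ℤ → ℝ) (x : ℤ × ℤ) :
    survOp p home [d] f x = stepMean p d fun s => if x + s = home then 0 else f (x + s) := by
  simp [survOp_apply, stepsMean_cons, aliveInd]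

theorem survOp_append (l₁ l₂ : List (ℤ × ℤ)) (f : ℤ × ℤ → ℝ) :
    survOp p home (l₁ ++ l₂) f = survOp p home l₁ (survOp p home l₂ f) := by
  ext x
  simp only [survOp_apply, stepsMean_append, aliveInd_append, List.sum_append,
    ← stepsMean_const_mul, mul_assoc, add_assoc]

theorem survOp_mono (hp : p ∈ Set.Icc (0 : ℝ) 1) (l : List (ℤ × ℤ)) :
    Monotone (survOp p home l) := fun _ _ h _ =>
  stepsMean_mono hp _ fun _ => mul_le_mul_of_nonneg_left (h _) (aliveInd_nonneg _ _)

theorem survOp_exp_le (hp : p ∈ Set.Icc (0 : ℝ) 1) {c : ℤ × ℤ →+ ℝ} {r : ℝ} {v : ℤ × ℤ → ℝ}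
    {l : List (ℤ × ℤ)} (h : ∀ d ∈ l, stepMean p d (fun s => Real.exp (r * c s))
      ≤ Real.exp (r * ((1 - p) * c d) + r ^ 2 / 2 * v d)) (hl : l.sum = 0) (x : ℤ × ℤ) :
    survOp p home l (fun y => Real.exp (r * c y)) x
      ≤ Real.exp (r ^ 2 / 2 * (l.map v).sum) * Real.exp (r * c x) := by
  have hexp := stepsMean_exp_le hp h
  rw [hl, map_zero, mul_zero, mul_zero, zero_add] at hexp
  calc _ ≤ stepsMean p l (fun a => Real.exp (r * c x) * Real.exp (r * c a.sum)) := by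
        refine stepsMean_mono hp _ fun a => ?_
        simp only [map_add, mul_add, Real.exp_add]
        exact mul_le_of_le_one_left (by positivity) (aliveInd_le_one _ _)
    _ = Real.exp (r * c x) * stepsMean p l (fun a => Real.exp (r * c a.sum)) :=
        stepsMean_const_mul _ _ _
    _ ≤ Real.exp (r * c x) * Real.exp (r ^ 2 / 2 * (l.map v).sum) := by gcongr
    _ = _ := mul_comm _ _

/-- The lists of steps with the following property: when the steps after the `(n + z)`-th one and up
to the `(n + M)`-th one are skipped, then one of the `m` subsequent steps, or the one before them,
ends at `u`. -/
def skipHits (n z M m : ℕ) (u : ℤ × ℤ) : Set (List (ℤ × ℤ)) :=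
  {c | ∃ k ≤ m, (c.take (n + z)).sum + ((c.take (n + M + k)).sum - (c.take (n + M)).sum) = u}

theorem append_append_mem_skipHits {a₀ a b : List (ℤ × ℤ)} {z : ℕ} (hz : z ≤ a.length)
    (m : ℕ) (u : ℤ × ℤ) :
    a₀ ++ (a ++ b) ∈ skipHits a₀.length z a.length m u ↔
      ∃ k ≤ m, (a₀ ++ (a.take z ++ b.take k)).sum = u := by
  have hlines (k : ℕ) : ((a₀ ++ (a ++ b)).take (a₀.length + a.length + k)).sum
      = a₀.sum + (a.sum + (b.take k).sum) := by
    rw [add_assoc, List.take_length_add_append, List.take_length_add_append, List.sum_append,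
      List.sum_append]
  have hstart := hlines 0
  simp only [List.take_zero, List.sum_nil, add_zero] at hstart
  simp only [skipHits, Set.mem_ofPred_eq, hlines, hstart]
  simp only [List.take_length_add_append, List.take_append_of_le_length hz, List.sum_append,
    add_assoc, add_sub_add_left_eq_sub, add_sub_cancel_left]

theorem aliveInd_add_indicator_skipHits_le_one (x : ℤ × ℤ) {a₀ a b e : List (ℤ × ℤ)} {z : ℕ}
    (hz : z ≤ a.length) (hpos : 0 < z) (m : ℕ) :
    aliveInd home x (a₀ ++ (a.take z ++ (b ++ e))) +
      (skipHits a₀.length z a.length m (home - x)).indicator 1 (a₀ ++ (a ++ b)) ≤ 1 := by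
  by_cases hit : a₀ ++ (a ++ b) ∈ skipHits a₀.length z a.length m (home - x)
  · obtain ⟨k, -, hk⟩ := (append_append_mem_skipHits hz _ _).1 hit
    have hsplit : a₀ ++ (a.take z ++ (b ++ e))
        = (a₀ ++ (a.take z ++ b.take k)) ++ (b.drop k ++ e) := by
      simp only [List.append_assoc, List.append_cancel_left_eq]
      rw [← List.append_assoc (b.take k), List.take_append_drop]
    have hdead : aliveInd home x (a₀ ++ (a.take z ++ (b ++ e))) = 0 := by
      rw [hsplit]
      refine aliveInd_append_eq_zero (List.ne_nil_of_length_pos ?_) (by rw [hk]; abel) _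
      simp only [List.length_append, List.length_take]
      omega
    simp [hdead, hit]
  · simpa [hit] using aliveInd_le_one _ _

theorem survOp_one_add_stepsProb_skipHits_le_one (hp : p ∈ Set.Icc (0 : ℝ) 1)
    {pre skip lines : List (ℤ × ℤ)} (post : List (ℤ × ℤ)) (hpre : ∀ d ∈ pre, d ∈ unitSteps)
    (hskip : ∀ d ∈ skip, d ∈ unitSteps) {z : ℕ} (hz : z ≤ skip.length) (hpos : 0 < z)
    (x : ℤ × ℤ) :
    survOp p home (pre ++ (skip.take z ++ (lines ++ post))) 1 x +
      stepsProb p (pre ++ (skip ++ lines))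
        (skipHits pre.length z skip.length lines.length (home - x)) ≤ 1 := by
  simp only [survOp_apply, stepsProb, stepsMean_append, Pi.one_apply, mul_one, stepsMean_take hz,
    ← stepsMean_add]
  refine (stepsMean_le_of_unitSteps hp hpre (Ψ := fun _ => 1) fun a₀ ha₀ _ => ?_).trans_eq
    (stepsMean_const _ _)
  refine (stepsMean_le_of_unitSteps hp hskip (Ψ := fun _ => 1) fun a ha _ => ?_).trans_eq
    (stepsMean_const _ _)
  refine (stepsMean_mono hp lines (b := fun _ => 1) fun b => ?_).trans_eq (stepsMean_const _ _)
  rw [← stepsMean_const (p := p) post (Set.indicator _ _ _), ← stepsMean_add]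
  refine (stepsMean_mono hp post (b := fun _ => 1) fun e => ?_).trans_eq (stepsMean_const _ _)
  rw [← ha₀, ← ha]
  exact aliveInd_add_indicator_skipHits_le_one x (hz.trans_eq ha.symm) hpos _

end Survival

/-! ### A sweep with small fluctuations finds the home with one of its offsets -/

section Sweep

theorem sum_take_line (W : ℕ) (east : Bool) {m : ℕ} (hm : m ≤ 2 * W) :
    ((List.replicate (2 * W) (if east then ((1 : ℤ), (0 : ℤ)) else (-1, 0))).take m).sum =
      ((if east then 1 else -1) * (m : ℤ), 0) := by
  rw [List.take_replicate, min_eq_left hm, List.sum_replicate]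
  cases east <;> simp

theorem exists_sum_take_sweepLines (W G : ℕ) {n : ℕ} (east : Bool) {j : ℕ} (hj : j < n) :
    ∃ k, k + 2 * W ≤ (sweepLines W G n east).length ∧ ∀ m ≤ 2 * W,
      ((sweepLines W G n east).take (k + m)).sum =
        ((if east then 1 else -1) * (if Even j then (m : ℤ) else 2 * W - m), (j * G : ℤ)) := by
  induction n, east using sweepLines.induct generalizing j with
  | case1 => omega
  | case2 east =>
    obtain rfl : j = 0 := by omega
    refine ⟨0, by simp [sweepLines], fun m hm => ?_⟩
    rw [sweepLines, zero_add, sum_take_line W east hm]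
    simp
  | case3 n east ih =>
    cases j with
    | zero =>
      refine ⟨0, by simp [sweepLines], fun m hm => ?_⟩
      rw [sweepLines, List.append_assoc, List.take_append_of_le_length (by simpa using hm),
        zero_add, sum_take_line W east hm]
      simp
    | succ j =>
      obtain ⟨k, hk, h⟩ := ih (Nat.lt_of_succ_lt_succ hj)
      refine ⟨2 * W + G + k, by simp [sweepLines]; omega, fun m hm => ?_⟩
      have hindex : 2 * W + G + k + m = (List.replicate (2 * W) (if east then ((1 : ℤ), (0 : ℤ))
          else (-1, 0)) ++ List.replicate G (0, 1)).length + (k + m) := by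
        simp [add_assoc]
      rw [sweepLines, hindex, List.take_length_add_append, List.sum_append, h m hm,
        List.sum_append, List.sum_replicate, List.sum_replicate]
      ext
      · cases east <;> by_cases hj : Even j <;> simp [hj, Nat.even_add_one] <;> ring
      · cases east <;> simp <;> ring

theorem exists_westward_index_sweepLines (W G : ℕ) {N j : ℕ} (hj : j < N) :
    ∃ idx : ℕ → ℕ,
      (∀ m ≤ 2 * W, idx m ≤ (sweepLines W G N true).length ∧
        ((sweepLines W G N true).take (idx m)).sum = (2 * (W : ℤ) - m, (j * G : ℤ))) ∧
      ∀ m < 2 * W, idx (m + 1) = idx m + 1 ∨ idx m = idx (m + 1) + 1 := by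
  obtain ⟨k, hk, hline⟩ := exists_sum_take_sweepLines W G true hj
  by_cases hev : Even j
  · refine ⟨fun m => k + (2 * W - m), fun m hm => ⟨by grind, ?_⟩, fun m hm => .inr (by grind)⟩
    rw [hline _ (Nat.sub_le _ _)]
    simp [hev, hm]
  · refine ⟨fun m => k + m, fun m hm => ⟨by grind, ?_⟩, fun m _ => .inl rfl⟩
    rw [hline _ hm]
    simp [hev]

theorem mem_unitSteps_of_mem_sweepLines {W G n : ℕ} {east : Bool} {d : ℤ × ℤ}
    (h : d ∈ sweepLines W G n east) : d ∈ unitSteps := by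
  have hhor (east : Bool) : (if east then ((1 : ℤ), (0 : ℤ)) else (-1, 0)) ∈ unitSteps := by
    cases east <;> decide
  induction n, east using sweepLines.induct with
  | case1 => simp [sweepLines] at h
  | case2 east =>
    rw [sweepLines] at h
    exact List.eq_of_mem_replicate h ▸ hhor east
  | case3 n east ih =>
    simp only [sweepLines, List.mem_append] at h
    rcases h with (h | h) | h
    · exact List.eq_of_mem_replicate h ▸ hhor east
    · rw [List.eq_of_mem_replicate h]; decide
    · exact ih h

/-- The instructions of a sweep that moves all `M` possible vertical offsets north before it
traverses the lines. A phase with offset `z` skips the last `M - z` of these northward steps; so the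
walks for all offsets can be read off a single walk. -/
def offsetSweep (W H G N M : ℕ) : List (ℤ × ℤ) :=
  (List.replicate W (-1, 0) ++ List.replicate H (0, -1)) ++
    (List.replicate M (0, 1) ++ sweepLines W G N true)

variable {W H G N M : ℕ}

theorem length_offsetSweep :
    (offsetSweep W H G N M).length = W + H + (M + (sweepLines W G N true).length) := by
  simp [offsetSweep, add_assoc]

theorem mem_unitSteps_of_mem_offsetSweep {d : ℤ × ℤ} (h : d ∈ offsetSweep W H G N M) :
    d ∈ unitSteps := by
  simp only [offsetSweep, List.mem_append] at h
  rcases h with (h | h) | h | h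
  iterate 3 rw [List.eq_of_mem_replicate h]; decide
  exact mem_unitSteps_of_mem_sweepLines h

theorem sum_take_offsetSweep_of_le {i : ℕ} (hi : i ≤ M) :
    ((offsetSweep W H G N M).take (W + H + i)).sum = (-(W : ℤ), -(H : ℤ) + i) := by
  have hlength : W + H = (List.replicate W ((-1 : ℤ), (0 : ℤ)) ++
      List.replicate H (0, -1)).length := by simp
  rw [offsetSweep, hlength, List.take_length_add_append,
    List.take_append_of_le_length (by simpa using hi), List.take_replicate, min_eq_left hi]
  simp

theorem sum_take_offsetSweep_add (k : ℕ) :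
    ((offsetSweep W H G N M).take (W + H + M + k)).sum =
      (-(W : ℤ), -(H : ℤ) + M) + ((sweepLines W G N true).take k).sum := by
  have hlength : W + H + M = ((List.replicate W ((-1 : ℤ), (0 : ℤ)) ++ List.replicate H (0, -1)) ++
      List.replicate M (0, 1)).length := by simp [add_assoc]
  rw [offsetSweep, ← List.append_assoc, hlength, List.take_length_add_append, List.sum_append]
  simp

/-- All fluctuations of the coordinates of the walk with steps `a`, given the instructions `l`, are
smaller than `δ`. -/
def IsClose (p δ : ℝ) (l a : List (ℤ × ℤ)) : Prop :=
  ∀ k ≤ l.length, |fluctuation p fstCoord l a k| < δ ∧ |fluctuation p sndCoord l a k| < δ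

variable {p δ : ℝ}

theorem stepsProb_not_isClose_le (hp : p ∈ Set.Icc (0 : ℝ) 1) (hδ : 0 < δ) {l : List (ℤ × ℤ)}
    (hl : ∀ d ∈ l, d ∈ unitSteps) :
    stepsProb p l {a | ¬IsClose p δ l a} ≤ 2 * l.length / δ ^ 2 := by
  have hevents : {a | ¬IsClose p δ l a} ⊆
      {a | ∃ k ≤ l.length, δ ≤ |0 + fluctuation p fstCoord l a k|} ∪
        {a | ∃ k ≤ l.length, δ ≤ |0 + fluctuation p sndCoord l a k|} := by
    intro a ha
    simp only [IsClose, Set.mem_ofPred_eq, not_forall, not_and_or, not_lt] at ha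
    obtain ⟨k, hk, h | h⟩ := ha
    · exact Or.inl ⟨k, hk, by rwa [zero_add]⟩
    · exact Or.inr ⟨k, hk, by rwa [zero_add]⟩
  calc _ ≤ _ := stepsProb_mono hp l hevents
    _ ≤ _ := stepsProb_union_le hp l _ _
    _ ≤ _ := add_le_add (stepsProb_fluctuation_le hp isCoordinate_fstCoord hδ hl 0)
        (stepsProb_fluctuation_le hp isCoordinate_sndCoord hδ hl 0)
    _ = _ := by ring

theorem IsClose.abs_sub_lt {l a : List (ℤ × ℤ)} (h : IsClose p δ l a) {k : ℕ} (hk : k ≤ l.length)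
    {v : ℤ × ℤ} (hv : (l.take k).sum = v) :
    |((a.take k).sum.1 : ℝ) - (1 - p) * v.1| < δ ∧
      |((a.take k).sum.2 : ℝ) - (1 - p) * v.2| < δ := by
  simpa only [fluctuation, hv, fstCoord_apply, sndCoord_apply] using h k hk

theorem exists_line_height {q g Y η : ℝ} {N : ℕ} (hg : 0 < q * g) (hη : 0 < η) (hY : η ≤ Y)
    (hYN : Y ≤ q * (N * g)) : ∃ j < N, η ≤ Y - q * (j * g) ∧ Y - q * (j * g) < η + q * g := by
  have hle : (⌊(Y - η) / (q * g)⌋₊ : ℝ) * (q * g) ≤ Y - η :=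
    (le_div_iff₀ hg).1 (Nat.floor_le (div_nonneg (by linarith) hg.le))
  have hlt : Y - η < (⌊(Y - η) / (q * g)⌋₊ + 1) * (q * g) :=
    (div_lt_iff₀ hg).1 (Nat.lt_floor_add_one _)
  have hlt_N : (⌊(Y - η) / (q * g)⌋₊ : ℝ) < N :=
    lt_of_mul_lt_mul_right (a := q * g) (by linarith) hg.le
  exact ⟨⌊(Y - η) / (q * g)⌋₊, by exact_mod_cast hlt_N, by linarith, by linarith⟩

theorem sub_mem_unitSteps_comm {u v : ℤ × ℤ} : u - v ∈ unitSteps ↔ v - u ∈ unitSteps := by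
  rw [← neg_sub v u]
  generalize v - u = d
  simp [unitSteps, Prod.ext_iff, neg_eq_iff_eq_neg]
  omega

theorem exists_column_add_line_eq {w bot top h : ℝ} {u : ℤ × ℤ} {S R : ℕ → ℤ × ℤ} {m n : ℕ}
    (hS : ∀ i < m, S (i + 1) - S i ∈ unitSteps) (hR : ∀ j < n, R (j + 1) - R j ∈ unitSteps)
    (hSx : ∀ i ≤ m, |((S i).1 : ℝ) + w| < δ) (hSbot : ((S 0).2 : ℝ) < bot + δ)
    (hStop : top - δ < (S m).2) (hReast : 2 * w - 2 * δ < (R 0).1) (hRwest : (R n).1 < 2 * δ)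
    (hRy : ∀ j ≤ n, |((R j).2 : ℝ) - h| < 2 * δ) (hu : |(u.1 : ℝ)| + 3 * δ ≤ w)
    (hbot : bot + 3 * δ ≤ u.2 - h) (htop : u.2 - h + 3 * δ + 1 ≤ top) :
    ∃ i ≤ m, ∃ j ≤ n, S i + R j = u := by
  have hu' := abs_le.1 (le_sub_iff_add_le.2 hu)
  obtain ⟨i, hi, j, hj, hij⟩ := exists_common_point (S := S) (Q := fun j => u - R j) hS
    (fun j hj => by simpa using sub_mem_unitSteps_comm.1 (hR j hj))
    (fun i hi => by
      have := abs_lt.1 (hSx i hi)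
      rify; simp; linarith)
    (fun i hi => by
      have := abs_lt.1 (hSx i hi)
      rify; simp; linarith)
    (fun j hj => by
      have := abs_lt.1 (hRy j hj)
      rify; simp; linarith)
    (fun j hj => by
      have := abs_lt.1 (hRy j hj)
      rify; simp; linarith)
  exact ⟨i, hi, j, hj, by simp [hij]⟩

theorem sum_take_succ_sub_mem {a : List (ℤ × ℤ)} (ha : ∀ s ∈ a, s ∈ unitSteps) {k : ℕ}
    (hk : k < a.length) : (a.take (k + 1)).sum - (a.take k).sum ∈ unitSteps := by
  rw [List.sum_take_succ _ _ hk, add_sub_cancel_left]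
  exact ha _ (List.getElem_mem hk)

theorem IsClose.abs_column_lt {a : List (ℤ × ℤ)} (h : IsClose p δ (offsetSweep W H G N M) a)
    {i : ℕ} (hi : i ≤ M) :
    |((a.take (W + H + i)).sum.1 : ℝ) + (1 - p) * W| < δ ∧
      |((a.take (W + H + i)).sum.2 : ℝ) - (1 - p) * (i - H)| < δ := by
  have hlen : W + H + i ≤ (offsetSweep W H G N M).length := by rw [length_offsetSweep]; omega
  convert h.abs_sub_lt hlen (sum_take_offsetSweep_of_le hi) using 3 <;> push_cast <;> ring

theorem IsClose.exists_line {a : List (ℤ × ℤ)} (h : IsClose p δ (offsetSweep W H G N M) a)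
    (ha : a.length = (offsetSweep W H G N M).length) (hunit : ∀ s ∈ a, s ∈ unitSteps)
    {j : ℕ} (hj : j < N) :
    ∃ R : ℕ → ℤ × ℤ,
      (∀ m < 2 * W, R (m + 1) - R m ∈ unitSteps) ∧
      ∀ m ≤ 2 * W, |((R m).1 : ℝ) - (1 - p) * (2 * W - m)| < 2 * δ ∧
        |((R m).2 : ℝ) - (1 - p) * (j * G)| < 2 * δ ∧
        ∃ k ≤ (sweepLines W G N true).length,
          R m = (a.take (W + H + M + k)).sum - (a.take (W + H + M)).sum := by
  rw [length_offsetSweep] at ha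
  obtain ⟨idx, hidx, hidx_succ⟩ := exists_westward_index_sweepLines W G hj
  refine ⟨fun m => (a.take (W + H + M + idx m)).sum - (a.take (W + H + M)).sum,
    fun m hm => ?_, fun m hm => ?_⟩
  · have hle := (hidx m hm.le).1
    have hle' := (hidx (m + 1) hm).1
    rw [sub_sub_sub_cancel_right]
    rcases hidx_succ m hm with h | h
    · rw [h]
      exact sum_take_succ_sub_mem hunit (k := W + H + M + idx m) (by omega)
    · rw [sub_mem_unitSteps_comm, h]
      exact sum_take_succ_sub_mem hunit (k := W + H + M + idx (m + 1)) (by omega)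
  · obtain ⟨hle, hsum⟩ := hidx m hm
    obtain ⟨hend1, hend2⟩ := h.abs_sub_lt (by rw [length_offsetSweep]; omega)
      ((sum_take_offsetSweep_add (idx m)).trans (congrArg _ hsum))
    obtain ⟨hstart1, hstart2⟩ := h.abs_column_lt le_rfl
    simp only [abs_lt, Prod.fst_add, Prod.snd_add, Prod.fst_sub, Prod.snd_sub] at *
    push_cast at *
    exact ⟨⟨by linarith, by linarith⟩, ⟨by linarith, by linarith⟩, idx m, hle, rfl⟩

theorem exists_offset_hits (hp0 : 0 ≤ p) (hp1 : p < 1) (hδ : 0 < δ) (hG : 0 < G) {u : ℤ × ℤ}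
    (hM : 6 * δ + 2 ≤ (1 - p) * ((M : ℝ) - G)) (hx : |(u.1 : ℝ)| + 3 * δ ≤ (1 - p) * W)
    (hy : 3 * δ + (1 - p) ≤ u.2 + (1 - p) * H) (hy' : u.2 + (1 - p) * H ≤ (1 - p) * (N * G))
    {a : List (ℤ × ℤ)} (ha : a.length = (offsetSweep W H G N M).length)
    (hunit : ∀ s ∈ a, s ∈ unitSteps) (hclose : IsClose p δ (offsetSweep W H G N M) a) :
    ∃ z ∈ Finset.Icc 1 M, a ∈ skipHits (W + H) z M (sweepLines W G N true).length u := by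
  have hq : 0 < 1 - p := by linarith
  have hM1 : 1 ≤ M := by
    have : 0 < (1 - p) * (M : ℝ) := by
      have : 0 ≤ (1 - p) * (G : ℝ) := by positivity
      linarith
    exact_mod_cast pos_of_mul_pos_right this hq.le
  obtain ⟨j, hj, hj1, hj2⟩ := exists_line_height (mul_pos hq (Nat.cast_pos.2 hG))
    (by linarith : 0 < 3 * δ + (1 - p)) hy hy'
  obtain ⟨R, hR, hline⟩ := hclose.exists_line ha hunit hj
  have hbot := abs_lt.1 (hclose.abs_column_lt hM1).2
  have htop := abs_lt.1 (hclose.abs_column_lt le_rfl).2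
  have heast := abs_lt.1 (hline 0 (by omega)).1
  have hwest := abs_lt.1 (hline (2 * W) le_rfl).1
  push_cast at hbot heast hwest
  rw [length_offsetSweep] at ha
  obtain ⟨i, hi, m, hm, him⟩ := exists_column_add_line_eq (δ := δ) (w := (1 - p) * W)
    (bot := (1 - p) * (1 - H)) (top := (1 - p) * (M - H)) (h := (1 - p) * (j * G)) (u := u)
    (S := fun i => (a.take (W + H + (i + 1))).sum) (R := R) (m := M - 1) (n := 2 * W)
    (fun i hi => sum_take_succ_sub_mem hunit (k := W + H + (i + 1)) (by omega)) hR
    (fun i hi => (hclose.abs_column_lt (by omega)).1) (by linarith)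
    (by rw [Nat.sub_add_cancel hM1]; linarith) (by linarith) (by linarith)
    (fun m hm => (hline m hm).2.1) hx (by linarith) (by linarith)
  obtain ⟨-, -, k, hk, hRk⟩ := hline m hm
  exact ⟨i + 1, Finset.mem_Icc.2 (by omega), k, hk, by rw [← him, hRk]⟩

theorem le_sum_one_sub_survOp {home : ℤ × ℤ} (hp0 : 0 ≤ p) (hp1 : p < 1) (hδ : 0 < δ) (hG : 0 < G)
    {x : ℤ × ℤ} (hM : 6 * δ + 2 ≤ (1 - p) * ((M : ℝ) - G))
    (hx : |((home - x).1 : ℝ)| + 3 * δ ≤ (1 - p) * W)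
    (hy : 3 * δ + (1 - p) ≤ (home - x).2 + (1 - p) * H)
    (hy' : (home - x).2 + (1 - p) * H ≤ (1 - p) * (N * G)) (post : ℕ → List (ℤ × ℤ)) :
    1 - 2 * (offsetSweep W H G N M).length / δ ^ 2 ≤
      ∑ z ∈ Finset.Icc 1 M, (1 - survOp p home
        ((List.replicate W (-1, 0) ++ List.replicate H (0, -1)) ++ (List.replicate z (0, 1) ++
          (sweepLines W G N true ++ post z))) 1 x) := by
  have hp : p ∈ Set.Icc (0 : ℝ) 1 := ⟨hp0, hp1.le⟩
  set lines := sweepLines W G N true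
  have hsweep : ∀ d ∈ offsetSweep W H G N M, d ∈ unitSteps := fun _ =>
    mem_unitSteps_of_mem_offsetSweep
  have hhits (z : ℕ) (hz : z ∈ Finset.Icc 1 M) :
      stepsProb p (offsetSweep W H G N M) (skipHits (W + H) z M lines.length (home - x)) ≤
        1 - survOp p home ((List.replicate W (-1, 0) ++ List.replicate H (0, -1)) ++
          (List.replicate z (0, 1) ++ (lines ++ post z))) 1 x := by
    obtain ⟨hz1, hzM⟩ := Finset.mem_Icc.1 hz
    have := survOp_one_add_stepsProb_skipHits_le_one (home := home) hp (z := z)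
      (pre := List.replicate W (-1, 0) ++ List.replicate H (0, -1))
      (skip := List.replicate M (0, 1)) (lines := lines) (post z)
      (fun d hd => hsweep d (List.mem_append_left _ hd))
      (fun d hd => hsweep d (List.mem_append_right _ (List.mem_append_left _ hd)))
      (by simpa using hzM) hz1 x
    rw [List.take_replicate, min_eq_left hzM, List.length_append] at this
    simp only [List.length_replicate] at this
    exact le_sub_iff_add_le'.2 this
  calc _ ≤ 1 - stepsProb p (offsetSweep W H G N M)
        {a | ¬IsClose p δ (offsetSweep W H G N M) a} := by
        gcongr; exact stepsProb_not_isClose_le hp hδ hsweep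
    _ ≤ stepsProb p (offsetSweep W H G N M)
        (⋃ z ∈ Finset.Icc 1 M, skipHits (W + H) z M lines.length (home - x)) := by
        rw [sub_le_iff_le_add']
        refine (one_le_stepsProb_of_unitSteps hp hsweep fun a ha hunit => ?_).trans
          (stepsProb_union_le hp _ _ _)
        rw [Set.mem_union, or_iff_not_imp_left, Set.notMem_ofPred_iff, not_not]
        intro hclose
        simpa only [Set.mem_iUnion, exists_prop] using
          exists_offset_hits hp0 hp1 hδ hG hM hx hy hy' ha hunit hclose
    _ ≤ _ := (stepsProb_biUnion_le hp _ _ _).trans (Finset.sum_le_sum hhits)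

end Sweep

/-! ### Phases and their durations -/

theorem sum_map_sweepLines {v : ℤ × ℤ → ℝ} {vh vv : ℝ} (heast : v (1, 0) = vh)
    (hwest : v (-1, 0) = vh) (hnorth : v (0, 1) = vv) (W G n : ℕ) (east : Bool) :
    ((sweepLines W G (n + 1) east).map v).sum = (n + 1) * (2 * W) * vh + n * G * vv := by
  induction n generalizing east with
  | zero => cases east <;> simp [sweepLines, heast, hwest]
  | succ n ih =>
    rw [sweepLines]
    simp only [List.map_append, List.sum_append, ih]
    cases east <;> simp [heast, hwest, hnorth] <;> ring

theorem sum_sweepLines (W G n : ℕ) (east : Bool) :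
    (sweepLines W G (n + 1) east).sum =
      ((if east then 1 else -1) * (if Even n then 2 * (W : ℤ) else 0), (n * G : ℤ)) := by
  induction n generalizing east with
  | zero => cases east <;> simp [sweepLines]
  | succ n ih =>
    rw [sweepLines]
    simp only [List.sum_append, ih]
    cases east <;> by_cases hn : Even n <;> simp [hn, Nat.even_add_one] <;> ring

namespace SweepParams

variable {P : SweepParams} {t z : ℕ}

variable (P) in
theorem exists_phase_eq_append (t z : ℕ) : ∃ post, P.phase t z =
    (List.replicate (P.W t) (-1, 0) ++ List.replicate (P.H t) (0, -1)) ++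
      (List.replicate z (0, 1) ++ (sweepLines (P.W t) (P.G t) (P.N t) true ++ post)) :=
  ⟨List.replicate (P.M t - z) (0, 1) ++
    (List.replicate (P.W t) (if Odd (P.N t) then (-1, 0) else (1, 0)) ++
      List.replicate ((P.N t - 1) * P.G t + P.M t - P.H t) (0, -1)),
    by simp only [phase, List.append_assoc]⟩

theorem mem_unitSteps_of_mem_phase {d : ℤ × ℤ} (h : d ∈ P.phase t z) : d ∈ unitSteps := by
  simp only [phase, List.mem_append] at h
  rcases h with (((((h | h) | h) | h) | h) | h) | h
  · rw [List.eq_of_mem_replicate h]; decide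
  · rw [List.eq_of_mem_replicate h]; decide
  · rw [List.eq_of_mem_replicate h]; decide
  · exact mem_unitSteps_of_mem_sweepLines h
  · rw [List.eq_of_mem_replicate h]; decide
  · rw [List.eq_of_mem_replicate h]; split_ifs <;> decide
  · rw [List.eq_of_mem_replicate h]; decide

theorem two_mul_H_le (hG : 0 < P.G t) : 2 * P.H t ≤ P.N t * P.G t := by
  have h := Nat.le_ceil ((2 * P.H t : ℝ) / P.G t)
  rw [div_le_iff₀ (by exact_mod_cast hG), ← N] at h
  exact_mod_cast h

theorem N_pos (hG : 0 < P.G t) (hH : 0 < P.H t) : 0 < P.N t :=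
  Nat.pos_of_mul_pos_right (b := P.G t) (by have := two_mul_H_le hG; omega)

theorem H_le (hG : 0 < P.G t) : P.H t ≤ (P.N t - 1) * P.G t + P.M t := by
  have hNG : P.N t * P.G t ≤ (P.N t - 1) * P.G t + P.G t := by
    rw [← Nat.succ_mul]; exact Nat.mul_le_mul_right _ (by omega)
  have hGM : P.G t ≤ P.M t := Nat.le_add_right _ _
  have := two_mul_H_le hG
  omega

theorem sum_map_phase {v : ℤ × ℤ → ℝ} {vh vv : ℝ} (heast : v (1, 0) = vh) (hwest : v (-1, 0) = vh)
    (hnorth : v (0, 1) = vv) (hsouth : v (0, -1) = vv) (hG : 0 < P.G t) (hH : 0 < P.H t)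
    (hz : z ≤ P.M t) :
    ((P.phase t z).map v).sum = (2 * P.W t * (P.N t + 1)) * vh +
      (2 * ((P.N t - 1) * P.G t) + 2 * P.M t) * vv := by
  have hle := H_le hG
  obtain ⟨n, hn⟩ := Nat.exists_eq_add_one_of_ne_zero (N_pos hG hH).ne'
  have hback : v (if Odd (n + 1) then (-1, 0) else (1, 0)) = vh := by split_ifs <;> assumption
  rw [hn] at hle
  simp only [phase, List.map_append, List.sum_append, hn, sum_map_sweepLines heast hwest hnorth,
    List.map_replicate, List.sum_replicate, hwest, hnorth, hsouth, hback, nsmul_eq_mul,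
    Nat.cast_sub hz, Nat.cast_sub hle]
  push_cast [Nat.add_sub_cancel]
  ring

theorem sum_phase (hG : 0 < P.G t) (hH : 0 < P.H t) (hz : z ≤ P.M t) :
    (P.phase t z).sum = 0 := by
  have hle := H_le hG
  obtain ⟨n, hn⟩ := Nat.exists_eq_add_one_of_ne_zero (N_pos hG hH).ne'
  rw [hn] at hle
  simp only [phase, List.sum_append, hn, sum_sweepLines, List.sum_replicate]
  ext
  · by_cases hn : Even n
    · simp [hn, -Nat.not_even_iff_odd]
      ring
    · simp [hn, ← Nat.not_even_iff_odd]
  · simp only [Prod.snd_add, Prod.smul_mk, nsmul_eq_mul, Nat.cast_sub hz, Nat.cast_sub hle]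
    split_ifs <;> push_cast [Nat.add_sub_cancel] <;> simp <;> ring

variable (P) in
/-- The duration of a phase that starts at time `t`. -/
noncomputable def duration (t : ℕ) : ℕ := (P.phase t 0).length

theorem length_phase (hz : z ≤ P.M t) : (P.phase t z).length = P.duration t := by
  simp only [duration, phase, List.length_append, List.length_replicate]
  omega

theorem duration_eq (hG : 0 < P.G t) (hH : 0 < P.H t) :
    (P.duration t : ℝ) = 2 * P.W t * (P.N t + 1) + (2 * ((P.N t - 1) * P.G t) + 2 * P.M t) := by
  simpa [duration] using sum_map_phase (v := fun _ => 1) rfl rfl rfl rfl hG hH (Nat.zero_le _)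

end SweepParams

section Growth

open Filter Topology

theorem sqrt_pos_and_log_pos {t : ℕ} (ht : 2 ≤ t) : 0 < √(t : ℝ) ∧ 0 < Real.log t := by
  have : (1 : ℝ) < t := by exact_mod_cast ht
  exact ⟨by positivity, Real.log_pos this⟩

theorem tendsto_sqrt_natCast : Tendsto (fun t : ℕ => √(t : ℝ)) atTop atTop :=
  Real.tendsto_sqrt_atTop.comp tendsto_natCast_atTop_atTop

theorem tendsto_log_natCast : Tendsto (fun t : ℕ => Real.log t) atTop atTop :=
  Real.tendsto_log_atTop.comp tendsto_natCast_atTop_atTop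

theorem tendsto_cbrt_natCast : Tendsto (fun t : ℕ => (t : ℝ) ^ (1 / 3 : ℝ)) atTop atTop :=
  (tendsto_rpow_atTop (by norm_num)).comp tendsto_natCast_atTop_atTop

theorem tendsto_cbrt_div_sqrt_div_log :
    Tendsto (fun t : ℕ => (t : ℝ) ^ (1 / 3 : ℝ) / (√(t : ℝ) / Real.log t)) atTop (𝓝 0) := by
  have hlog := (isLittleO_log_rpow_atTop (r := 1 / 6) (by norm_num)).tendsto_div_nhds_zero.comp
    (tendsto_natCast_atTop_atTop (R := ℝ))
  refine hlog.congr' ?_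
  filter_upwards [eventually_ge_atTop 1] with t ht
  have ht' : (0 : ℝ) < t := by exact_mod_cast ht
  have hsqrt : √(t : ℝ) = (t : ℝ) ^ (1 / 3 : ℝ) * (t : ℝ) ^ (1 / 6 : ℝ) := by
    rw [Real.sqrt_eq_rpow, ← Real.rpow_add ht']; norm_num
  have : (0 : ℝ) < (t : ℝ) ^ (1 / 3 : ℝ) := by positivity
  simp only [Function.comp_apply, hsqrt]
  field_simp

theorem tendsto_sqrt_div_log :
    Tendsto (fun t : ℕ => √(t : ℝ) / Real.log t) atTop atTop := by
  refine tendsto_atTop_mono' _ ?_ tendsto_cbrt_natCast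
  filter_upwards [tendsto_cbrt_div_sqrt_div_log.eventually (gt_mem_nhds one_pos),
    eventually_ge_atTop 2] with t hlt ht
  obtain ⟨hsqrt, hlog⟩ := sqrt_pos_and_log_pos ht
  exact ((div_lt_one (div_pos hsqrt hlog)).1 hlt).le

theorem tendsto_cbrt_div_sqrt :
    Tendsto (fun t : ℕ => (t : ℝ) ^ (1 / 3 : ℝ) / √(t : ℝ)) atTop (𝓝 0) := by
  have h := tendsto_cbrt_div_sqrt_div_log.mul tendsto_log_natCast.inv_tendsto_atTop
  rw [zero_mul] at h
  refine h.congr' ?_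
  filter_upwards [eventually_ge_atTop 2] with t ht
  obtain ⟨_, hlog⟩ := sqrt_pos_and_log_pos ht
  simp only [Pi.inv_apply]
  field_simp

theorem tendsto_ceil_mul_sqrt_div_sqrt {a q : ℝ} (h : 0 ≤ a / q) :
    Tendsto (fun t : ℕ => (⌈1 / q * (a * √(t : ℝ))⌉₊ : ℝ) / √(t : ℝ)) atTop (𝓝 (a / q)) := by
  refine ((tendsto_nat_ceil_mul_div_atTop h).comp tendsto_sqrt_natCast).congr fun t => ?_
  simp only [Function.comp_apply]
  ring_nf

theorem eventually_margin_le {p p₀ a : ℝ} (hp : p < p₀) (hp₀ : p₀ < 1) (ha : 0 < a) (K κ : ℝ) :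
    ∀ᶠ t : ℕ in atTop, a * √(t : ℝ) + K + κ * (t : ℝ) ^ (1 / 3 : ℝ) ≤
      (1 - p) * (1 / (1 - p₀) * (a * √(t : ℝ))) := by
  have hq : 0 < 1 - p₀ := by linarith
  have hlim : Tendsto (fun t : ℕ => K / √(t : ℝ) + κ * ((t : ℝ) ^ (1 / 3 : ℝ) / √(t : ℝ))) atTop
      (𝓝 (0 + κ * 0)) :=
    (tendsto_sqrt_natCast.const_div_atTop K).add (tendsto_cbrt_div_sqrt.const_mul κ)
  have hgain : 0 + κ * 0 < a * ((1 - p) / (1 - p₀) - 1) := by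
    rw [mul_zero, zero_add]
    exact mul_pos ha (by rw [sub_pos, one_lt_div hq]; linarith)
  filter_upwards [hlim.eventually (gt_mem_nhds hgain), eventually_ge_atTop 2] with t hlt ht
  have := (sqrt_pos_and_log_pos ht).1
  calc a * √(t : ℝ) + K + κ * (t : ℝ) ^ (1 / 3 : ℝ)
      = a * √(t : ℝ) + (K / √(t : ℝ) + κ * ((t : ℝ) ^ (1 / 3 : ℝ) / √(t : ℝ))) * √(t : ℝ) := by
        field_simp
        ring
    _ ≤ a * √(t : ℝ) + a * ((1 - p) / (1 - p₀) - 1) * √(t : ℝ) := by gcongr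
    _ = (1 - p) * (1 / (1 - p₀) * (a * √(t : ℝ))) := by ring

end Growth

namespace SweepParams

open Filter Topology

variable {P : SweepParams}

theorem G_pos (hp : P.p₀ < 1) {t : ℕ} (ht : 2 ≤ t) : 0 < P.G t := by
  obtain ⟨_, _⟩ := sqrt_pos_and_log_pos ht
  have : 0 < 1 - P.p₀ := by linarith
  exact Nat.ceil_pos.2 (by positivity)

theorem H_pos (hp : P.p₀ < 1) (hB : 0 < P.B) {t : ℕ} (ht : 2 ≤ t) : 0 < P.H t := by
  have := (sqrt_pos_and_log_pos ht).1
  have : 0 < 1 - P.p₀ := by linarith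
  exact Nat.ceil_pos.2 (by positivity)

theorem cbrt_le_M_sub_G (t : ℕ) : (t : ℝ) ^ (1 / 3 : ℝ) ≤ (P.M t : ℝ) - P.G t := by
  rw [M, Nat.cast_add, add_sub_cancel_left]
  exact Nat.le_ceil _

theorem N_sub_one_mul_G_le {t : ℕ} (hG : 0 < P.G t) : ((P.N t : ℝ) - 1) * P.G t ≤ 2 * P.H t := by
  have hceil := Nat.ceil_lt_add_one (show (0 : ℝ) ≤ (2 * P.H t : ℝ) / P.G t by positivity)
  rw [← N] at hceil
  rw [← le_div_iff₀ (by exact_mod_cast hG)]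
  linarith

theorem tendsto_W_div_sqrt (hp : P.p₀ < 1) (hA : 0 < P.A) :
    Tendsto (fun t : ℕ => (P.W t : ℝ) / √(t : ℝ)) atTop (𝓝 (P.A / (1 - P.p₀))) :=
  tendsto_ceil_mul_sqrt_div_sqrt (div_nonneg hA.le (by linarith))

theorem tendsto_H_div_sqrt (hp : P.p₀ < 1) (hB : 0 < P.B) :
    Tendsto (fun t : ℕ => (P.H t : ℝ) / √(t : ℝ)) atTop (𝓝 (P.B / (1 - P.p₀))) :=
  tendsto_ceil_mul_sqrt_div_sqrt (div_nonneg hB.le (by linarith))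

theorem tendsto_G_div_sqrt_div_log (hp : P.p₀ < 1) :
    Tendsto (fun t : ℕ => (P.G t : ℝ) / (√(t : ℝ) / Real.log t)) atTop (𝓝 (1 / (1 - P.p₀))) :=
  (tendsto_nat_ceil_mul_div_atTop (by have : 0 < 1 - P.p₀ := by linarith
                                      positivity)).comp tendsto_sqrt_div_log

theorem tendsto_cbrt_div_G (hp : P.p₀ < 1) :
    Tendsto (fun t : ℕ => (t : ℝ) ^ (1 / 3 : ℝ) / P.G t) atTop (𝓝 0) := by
  have : 0 < 1 - P.p₀ := by linarith
  have h := tendsto_cbrt_div_sqrt_div_log.mul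
    ((tendsto_G_div_sqrt_div_log hp).inv₀ (by positivity))
  rw [zero_mul] at h
  refine h.congr' ?_
  filter_upwards [eventually_ge_atTop 2] with t ht
  have hG : (0 : ℝ) < P.G t := by exact_mod_cast G_pos hp ht
  obtain ⟨_, _⟩ := sqrt_pos_and_log_pos ht
  field_simp

theorem tendsto_M_div_G (hp : P.p₀ < 1) :
    Tendsto (fun t : ℕ => (P.M t : ℝ) / P.G t) atTop (𝓝 1) := by
  have hceil : Tendsto (fun t : ℕ => (⌈(t : ℝ) ^ (1 / 3 : ℝ)⌉₊ : ℝ) / (t : ℝ) ^ (1 / 3 : ℝ)) atTop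
      (𝓝 1) := tendsto_nat_ceil_div_atTop.comp tendsto_cbrt_natCast
  have h := (hceil.mul (tendsto_cbrt_div_G hp)).const_add 1
  rw [mul_zero, add_zero] at h
  refine h.congr' ?_
  filter_upwards [eventually_ge_atTop 2] with t ht
  have hG : (0 : ℝ) < P.G t := by exact_mod_cast G_pos hp ht
  have : 0 < (t : ℝ) ^ (1 / 3 : ℝ) := by positivity
  rw [M, Nat.cast_add]
  field_simp

theorem tendsto_M_div_sqrt (hp : P.p₀ < 1) :
    Tendsto (fun t : ℕ => (P.M t : ℝ) / √(t : ℝ)) atTop (𝓝 0) := by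
  have h := ((tendsto_M_div_G hp).mul (tendsto_G_div_sqrt_div_log hp)).mul
    tendsto_log_natCast.inv_tendsto_atTop
  rw [mul_zero] at h
  refine h.congr' ?_
  filter_upwards [eventually_ge_atTop 2] with t ht
  have hG : (0 : ℝ) < P.G t := by exact_mod_cast G_pos hp ht
  obtain ⟨_, _⟩ := sqrt_pos_and_log_pos ht
  simp only [Pi.inv_apply]
  field_simp

theorem tendsto_N (hp : P.p₀ < 1) (hB : 0 < P.B) :
    Tendsto (fun t : ℕ => (P.N t : ℝ)) atTop atTop := by
  have : 0 < 1 - P.p₀ := by linarith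
  have h := Tendsto.pos_mul_atTop (by positivity) ((tendsto_H_div_sqrt hp hB).mul
    ((tendsto_G_div_sqrt_div_log hp).inv₀ (by positivity))) tendsto_log_natCast
  refine tendsto_atTop_mono' _ ?_ h
  filter_upwards [eventually_ge_atTop 2] with t ht
  have hG : (0 : ℝ) < P.G t := by exact_mod_cast G_pos hp ht
  obtain ⟨_, _⟩ := sqrt_pos_and_log_pos ht
  calc (P.H t : ℝ) / √(t : ℝ) * (P.G t / (√(t : ℝ) / Real.log t))⁻¹ * Real.log t
      = P.H t / P.G t := by field_simp
    _ ≤ 2 * P.H t / P.G t := by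
      gcongr
      linarith [(Nat.cast_nonneg (P.H t) : (0 : ℝ) ≤ _)]
    _ ≤ P.N t := Nat.le_ceil _

theorem duration_mul_M_le {t : ℕ} (hG : 0 < P.G t) (hH : 0 < P.H t) :
    (P.duration t : ℝ) * P.M t ≤ 4 * P.W t * P.H t * (P.M t / P.G t) + 4 * P.W t * P.M t +
      4 * P.H t * P.M t + 2 * P.M t * P.M t := by
  have hG' : (0 : ℝ) < P.G t := by exact_mod_cast hG
  have hNG := N_sub_one_mul_G_le hG
  have hN : (P.N t : ℝ) + 1 ≤ 2 * P.H t / P.G t + 2 := by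
    have := (le_div_iff₀ hG').2 hNG
    linarith
  calc (P.duration t : ℝ) * P.M t
      ≤ (2 * P.W t * (2 * P.H t / P.G t + 2) + (2 * (2 * P.H t) + 2 * P.M t)) * P.M t := by
        rw [duration_eq hG hH]
        gcongr
    _ = _ := by
        field_simp
        ring

theorem eventually_duration_mul_M_le (hp : P.p₀ < 1) (hA : 0 < P.A) (hB : 0 < P.B) {q : ℝ}
    (hq : 4 * (P.A / (1 - P.p₀)) * (P.B / (1 - P.p₀)) < q) :
    ∀ᶠ t : ℕ in atTop, (P.duration t : ℝ) * P.M t ≤ q * t := by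
  have hW := (tendsto_W_div_sqrt hp hA).const_mul 4
  have hH := tendsto_H_div_sqrt hp hB
  have hM := tendsto_M_div_sqrt hp
  have hlim := ((((hW.mul hH).mul (tendsto_M_div_G hp)).add (hW.mul hM)).add
    ((hH.const_mul 4).mul hM)).add ((hM.const_mul 2).mul hM)
  simp only [mul_one, mul_zero, add_zero] at hlim
  filter_upwards [hlim.eventually (gt_mem_nhds hq), eventually_ge_atTop 2] with t hlt ht
  have := (sqrt_pos_and_log_pos ht).1
  refine (duration_mul_M_le (G_pos hp ht) (H_pos hp hB ht)).trans ?_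
  calc _ = (4 * (P.W t / √(t : ℝ)) * (P.H t / √(t : ℝ)) * (P.M t / P.G t)
        + 4 * (P.W t / √(t : ℝ)) * (P.M t / √(t : ℝ)) + 4 * (P.H t / √(t : ℝ)) * (P.M t / √(t : ℝ))
        + 2 * (P.M t / √(t : ℝ)) * (P.M t / √(t : ℝ))) * (√(t : ℝ) * √(t : ℝ)) := by
        field_simp
    _ ≤ q * (√(t : ℝ) * √(t : ℝ)) := by gcongr
    _ = q * t := by rw [Real.mul_self_sqrt (Nat.cast_nonneg t)]

theorem eventually_duration_le_mul_sq_cbrt (hp : P.p₀ < 1) (hA : 0 < P.A) (hB : 0 < P.B) {ε : ℝ}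
    (hε : 0 < ε) :
    ∀ᶠ t : ℕ in atTop, (P.duration t : ℝ) ≤ ε * ((t : ℝ) ^ (1 / 3 : ℝ)) ^ 2 := by
  have : 0 < 1 - P.p₀ := by linarith
  set q := 4 * (P.A / (1 - P.p₀)) * (P.B / (1 - P.p₀)) + 1
  have hq : 0 < q := by positivity
  filter_upwards [eventually_duration_mul_M_le hp hA hB (lt_add_one _),
    (tendsto_cbrt_div_G hp).eventually (gt_mem_nhds (div_pos hε hq)), eventually_ge_atTop 2]
    with t hDM hcbrt ht
  have hG : (0 : ℝ) < P.G t := by exact_mod_cast G_pos hp ht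
  have hGM : (P.G t : ℝ) ≤ P.M t := by exact_mod_cast Nat.le_add_right _ _
  set y := (t : ℝ) ^ (1 / 3 : ℝ) with hy
  have hy3 : (t : ℝ) = y ^ 3 := by
    rw [hy, ← Real.rpow_natCast, ← Real.rpow_mul (Nat.cast_nonneg t)]; norm_num
  rw [div_lt_div_iff₀ hG hq] at hcbrt
  refine le_of_mul_le_mul_right ?_ hG
  calc (P.duration t : ℝ) * P.G t ≤ P.duration t * P.M t := by gcongr
    _ ≤ q * t := hDM
    _ = y * q * y ^ 2 := by rw [hy3]; ring
    _ ≤ ε * P.G t * y ^ 2 := by gcongr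
    _ = ε * y ^ 2 * P.G t := by ring

theorem eventually_duration_le (hp : P.p₀ < 1) (hA : 0 < P.A) (hB : 0 < P.B) {ε : ℝ}
    (hε : 0 < ε) : ∀ᶠ t : ℕ in atTop, (P.duration t : ℝ) ≤ ε * t := by
  filter_upwards [eventually_duration_le_mul_sq_cbrt hp hA hB hε, eventually_ge_atTop 1]
    with t hD ht
  refine hD.trans (mul_le_mul_of_nonneg_left ?_ hε.le)
  rw [← Real.rpow_natCast, ← Real.rpow_mul (by positivity)]
  exact Real.rpow_le_self_of_one_le (by exact_mod_cast ht) (by norm_num)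

theorem eventually_vertical_le (hp : P.p₀ < 1) (hA : 0 < P.A) (hB : 0 < P.B) {ε : ℝ}
    (hε : 0 < ε) : ∀ᶠ t : ℕ in atTop,
      2 * (((P.N t : ℝ) - 1) * P.G t) + 2 * P.M t ≤ ε * P.duration t := by
  have : 0 < 1 - P.p₀ := by linarith
  have hA' : 0 < P.A / (1 - P.p₀) := by positivity
  set C := P.B / (1 - P.p₀) + 1
  have hC : 0 < C := by positivity
  filter_upwards [(tendsto_W_div_sqrt hp hA).eventually (lt_mem_nhds (half_lt_self hA')),
    (tendsto_H_div_sqrt hp hB).eventually (gt_mem_nhds (lt_add_one _)),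
    (tendsto_M_div_sqrt hp).eventually (gt_mem_nhds hC),
    (tendsto_N hp hB).eventually_ge_atTop (6 * C / (ε * (P.A / (1 - P.p₀)))),
    eventually_ge_atTop 2] with t hW hH hM hN ht
  have hG := G_pos hp ht
  have hNG := N_sub_one_mul_G_le hG
  have hN1 : (1 : ℝ) ≤ P.N t := by exact_mod_cast N_pos hG (H_pos hp hB ht)
  have hvert : 0 ≤ ((P.N t : ℝ) - 1) * P.G t := mul_nonneg (by linarith) (Nat.cast_nonneg _)
  have hsqrt := (sqrt_pos_and_log_pos ht).1
  rw [lt_div_iff₀ hsqrt] at hW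
  rw [div_lt_iff₀ hsqrt] at hH hM
  rw [div_le_iff₀ (by positivity)] at hN
  calc 2 * (((P.N t : ℝ) - 1) * P.G t) + 2 * P.M t ≤ 4 * (C * √t) + 2 * (C * √t) := by linarith
    _ = 6 * C * √t := by ring
    _ ≤ P.N t * (ε * (P.A / (1 - P.p₀))) * √t := by gcongr
    _ = ε * (2 * (P.A / (1 - P.p₀) / 2 * √t) * P.N t) := by ring
    _ ≤ ε * (2 * P.W t * P.N t) := by gcongr
    _ ≤ ε * P.duration t := by
      rw [duration_eq hG (H_pos hp hB ht)]
      gcongr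
      linarith [(P.W t).cast_nonneg (α := ℝ), (P.M t).cast_nonneg (α := ℝ)]

/-- The survival operator of a phase that starts at time `t`, averaged over its offset. -/
noncomputable def phaseOp (P : SweepParams) (p : ℝ) (home : ℤ × ℤ) (t : ℕ) :
    (ℤ × ℤ → ℝ) →ₗ[ℝ] (ℤ × ℤ → ℝ) :=
  (P.M t : ℝ)⁻¹ • ∑ z ∈ Finset.Icc 1 (P.M t), survOp p home (P.phase t z)

variable {P : SweepParams} {p : ℝ} {home : ℤ × ℤ}

theorem phaseOp_apply (t : ℕ) (f : ℤ × ℤ → ℝ) (x : ℤ × ℤ) : P.phaseOp p home t f x =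
    (P.M t : ℝ)⁻¹ * ∑ z ∈ Finset.Icc 1 (P.M t), survOp p home (P.phase t z) f x := by
  simp [phaseOp, LinearMap.smul_apply, LinearMap.sum_apply]

theorem phaseOp_mono (hp : p ∈ Set.Icc (0 : ℝ) 1) (t : ℕ) : Monotone (P.phaseOp p home t) :=
  fun f g h x => by
    rw [phaseOp_apply, phaseOp_apply]
    exact mul_le_mul_of_nonneg_left (Finset.sum_le_sum fun z _ => survOp_mono hp _ h x)
      (by positivity)

theorem phaseOp_le_of_forall {t : ℕ} (ht : 1 ≤ t) {f : ℤ × ℤ → ℝ} {x : ℤ × ℤ} {K : ℝ}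
    (h : ∀ z ∈ Finset.Icc 1 (P.M t), survOp p home (P.phase t z) f x ≤ K) :
    P.phaseOp p home t f x ≤ K := by
  have hM : (0 : ℝ) < P.M t := by exact_mod_cast P.one_le_M ht
  rw [phaseOp_apply, inv_mul_le_iff₀ hM]
  exact (Finset.sum_le_sum h).trans_eq (by simp)

theorem phaseOp_one_le_one (hp : p ∈ Set.Icc (0 : ℝ) 1) {t : ℕ} (ht : 1 ≤ t) (x : ℤ × ℤ) :
    P.phaseOp p home t 1 x ≤ 1 := by
  refine phaseOp_le_of_forall ht fun z _ => ?_
  rw [survOp_apply]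
  refine (stepsMean_mono hp _ fun a => ?_).trans_eq (stepsMean_const _ 1)
  simpa using aliveInd_le_one x a

theorem length_offsetSweep_le_duration (t : ℕ) :
    (offsetSweep (P.W t) (P.H t) (P.G t) (P.N t) (P.M t)).length ≤ P.duration t := by
  simp only [← length_phase (le_refl (P.M t)), length_offsetSweep, phase, List.length_append,
    List.length_replicate]
  omega

theorem phaseOp_one_le (hp0 : 0 ≤ p) (hp1 : p < 1) {δ : ℝ} (hδ : 0 < δ) {t : ℕ} (ht : 1 ≤ t)
    (hG : 0 < P.G t) {x : ℤ × ℤ} (hM : 6 * δ + 2 ≤ (1 - p) * ((P.M t : ℝ) - P.G t))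
    (hx : |((home - x).1 : ℝ)| + 3 * δ ≤ (1 - p) * P.W t)
    (hy : |((home - x).2 : ℝ)| + 3 * δ + (1 - p) ≤ (1 - p) * P.H t) :
    P.phaseOp p home t 1 x ≤ 1 - (1 - 2 * P.duration t / δ ^ 2) / P.M t := by
  have hMpos : (0 : ℝ) < P.M t := by exact_mod_cast P.one_le_M ht
  have hNG : (1 - p) * (2 * P.H t : ℝ) ≤ (1 - p) * (P.N t * P.G t) :=
    mul_le_mul_of_nonneg_left (by exact_mod_cast two_mul_H_le hG) (by linarith)
  have habs := abs_le.1 (le_refl |((home - x).2 : ℝ)|)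
  choose post hpost using P.exists_phase_eq_append t
  have hhits := le_sum_one_sub_survOp (W := P.W t) (H := P.H t) (N := P.N t) hp0 hp1 hδ hG hM hx
    (by linarith [habs.1]) (by linarith [habs.2]) post
  have hlen : ((offsetSweep (P.W t) (P.H t) (P.G t) (P.N t) (P.M t)).length : ℝ) ≤ P.duration t :=
    by exact_mod_cast length_offsetSweep_le_duration t
  simp only [← hpost, Finset.sum_sub_distrib, Finset.sum_const, Nat.card_Icc, Nat.add_sub_cancel,
    nsmul_eq_mul, mul_one] at hhits
  rw [phaseOp_apply, inv_mul_le_iff₀ hMpos, mul_sub, mul_one, mul_div_cancel₀ _ hMpos.ne']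
  have herr : 2 * ((offsetSweep (P.W t) (P.H t) (P.G t) (P.N t) (P.M t)).length : ℝ) / δ ^ 2 ≤
      2 * P.duration t / δ ^ 2 := by gcongr
  linarith

theorem eventually_phaseOp_one_le (hp0 : 0 ≤ p) (hp : p < P.p₀) (hP : P.p₀ < 1) (hA : 0 < P.A)
    (hB : 0 < P.B) (home : ℤ × ℤ) {ε : ℝ} (hε : 0 < ε) :
    ∀ᶠ t : ℕ in atTop, ∀ x : ℤ × ℤ, |(x.1 : ℝ)| ≤ P.A * √(t : ℝ) → |(x.2 : ℝ)| ≤ P.B * √(t : ℝ) →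
      P.phaseOp p home t 1 x ≤ 1 - (1 - ε) / P.M t := by
  have hq : 0 < 1 - P.p₀ := by linarith
  set κ := (1 - P.p₀) / 12
  have : 0 < κ := by positivity
  filter_upwards [eventually_duration_le_mul_sq_cbrt hP hA hB (ε := ε * κ ^ 2 / 2) (by positivity),
    eventually_margin_le hp hP hA |(home.1 : ℝ)| (3 * κ),
    eventually_margin_le hp hP hB (|(home.2 : ℝ)| + 1) (3 * κ),
    tendsto_cbrt_natCast.eventually_ge_atTop (4 / (1 - P.p₀)), eventually_ge_atTop 2]
    with t hD hmarginW hmarginH hcbrt ht x hx hy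
  set y := (t : ℝ) ^ (1 / 3 : ℝ)
  have hypos : 0 < y := (div_pos (by norm_num) hq).trans_le hcbrt
  have hq' : 0 < 1 - p := by linarith
  have hW : (1 - p) * (1 / (1 - P.p₀) * (P.A * √(t : ℝ))) ≤ (1 - p) * P.W t := by
    gcongr; exact Nat.le_ceil _
  have hH : (1 - p) * (1 / (1 - P.p₀) * (P.B * √(t : ℝ))) ≤ (1 - p) * P.H t := by
    gcongr; exact Nat.le_ceil _
  have hM : 6 * (κ * y) + 2 ≤ (1 - p) * ((P.M t : ℝ) - P.G t) := by
    rw [div_le_iff₀ hq] at hcbrt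
    calc 6 * (κ * y) + 2 ≤ (1 - P.p₀) * y := by simp only [κ]; linarith
      _ ≤ (1 - p) * ((P.M t : ℝ) - P.G t) := by gcongr; exact P.cbrt_le_M_sub_G t
  refine (phaseOp_one_le hp0 (hp.trans hP) (δ := κ * y) (by positivity) (by omega) (G_pos hP ht) hM
    ?_ ?_).trans ?_
  · push_cast [Prod.fst_sub]
    linarith [abs_sub (home.1 : ℝ) x.1]
  · push_cast [Prod.snd_sub]
    linarith [abs_sub (home.2 : ℝ) x.2]
  · gcongr
    rw [div_le_iff₀ (by positivity)]
    linarith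

theorem eventually_phaseOp_exp_le (hp : p ∈ Set.Icc (0 : ℝ) 1) (hP : P.p₀ < 1)
    (hB : 0 < P.B) {c : ℤ × ℤ →+ ℝ} (hc : IsCoordinate c) {vh vv s : ℝ}
    (hvh : stepVar p (c (1, 0)) < vh) (hvv : stepVar p (c (0, 1)) < vv)
    (hs : ∀ᶠ t : ℕ in atTop, (2 * P.W t * (P.N t + 1)) * vh +
      (2 * ((P.N t - 1) * P.G t) + 2 * P.M t) * vv ≤ s * P.duration t) (home : ℤ × ℤ) :
    ∀ᶠ rt : ℝ × ℕ in 𝓝 0 ×ˢ atTop, ∀ x,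
      P.phaseOp p home rt.2 (fun y => Real.exp (rt.1 * c y)) x ≤
        Real.exp (rt.1 ^ 2 / 2 * (s * P.duration rt.2)) * Real.exp (rt.1 * c x) := by
  set v : ℤ × ℤ → ℝ := fun d => if d.2 = 0 then vh else vv
  have hv : ∀ d ∈ unitSteps, stepVar p (c d) < v d := by
    have hwest : stepVar p (c (-1, 0)) = stepVar p (c (1, 0)) := by
      rw [← neg_zero, ← Prod.neg_mk, map_neg, stepVar, stepVar, neg_sq, neg_zero]
    have hsouth : stepVar p (c (0, -1)) = stepVar p (c (0, 1)) := by
      rw [← neg_zero, ← Prod.neg_mk, map_neg, stepVar, stepVar, neg_sq, neg_zero]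
    simp [unitSteps, v, hwest, hsouth, hvh, hvv]
  filter_upwards [(eventually_forall_stepMean_exp_le hp hc hv).prod_mk
    (hs.and (eventually_ge_atTop 2))]
  rintro ⟨r, t⟩ ⟨hr, hs, ht⟩ x
  refine phaseOp_le_of_forall (by omega) fun z hz => ?_
  have hzM := (Finset.mem_Icc.1 hz).2
  have hG := G_pos hP ht
  have hH := H_pos hP hB ht
  refine (survOp_exp_le hp (fun d hd => hr d (mem_unitSteps_of_mem_phase hd))
    (sum_phase hG hH hzM) x).trans ?_
  rw [sum_map_phase (v := v) rfl rfl rfl rfl hG hH hzM]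
  simp only [v, if_true, one_ne_zero, if_false]
  gcongr

end SweepParams

/-! ### Polynomial decay of the surviving mass -/

section PolynomialDecay

open Filter

theorem exp_mul_le_of_mem_Icc {θ : ℝ} (hθ : θ ∈ Set.Icc (0 : ℝ) 1) (y κ : ℝ) :
    Real.exp (θ * y) ≤ Real.exp (θ * κ) * (θ * Real.exp (-κ) * Real.exp y + (1 - θ)) := by
  have hconvex : Real.exp (θ * (y - κ)) ≤ θ * Real.exp (y - κ) + (1 - θ) := by
    simpa using convexOn_exp.2 (Set.mem_univ (y - κ)) (Set.mem_univ 0) hθ.1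
      (sub_nonneg.2 hθ.2) (add_sub_cancel θ 1)
  calc Real.exp (θ * y) = Real.exp (θ * κ) * Real.exp (θ * (y - κ)) := by
        rw [← Real.exp_add]; ring_nf
    _ ≤ Real.exp (θ * κ) * (θ * Real.exp (y - κ) + (1 - θ)) := by gcongr
    _ = _ := by rw [mul_assoc θ, ← Real.exp_add, neg_add_eq_sub]

theorem rpow_neg_mul_exp_le {T T' h : ℝ} (hT : 0 < T) (hT' : 0 < T') (hh : 0 ≤ h) :
    T ^ (-h) * Real.exp (-(h * (T' - T) / T)) ≤ T' ^ (-h) := by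
  have hlog : Real.log T' - Real.log T ≤ (T' - T) / T := by
    rw [← Real.log_div hT'.ne' hT.ne', sub_div, div_self hT.ne']
    exact Real.log_le_sub_one_of_pos (div_pos hT' hT)
  rw [Real.rpow_def_of_pos hT, Real.rpow_def_of_pos hT', ← Real.exp_add, Real.exp_le_exp,
    mul_div_assoc]
  linarith [mul_le_mul_of_nonneg_left hlog hh]

theorem rescaled_exponent_le {T T' h h' α : ℝ} (hT : 0 < T) (hTT' : T ≤ T') (hh' : 0 ≤ h')
    (hgrowth : h * T' ≤ h' * T) :
    (α / √T') ^ 2 / 2 * (T' - T) + √T / √T' * (2 * h' + α ^ 2) ≤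
      2 * h' + α ^ 2 - h * (T' - T) / T := by
  have hT' : 0 < T' := hT.trans_le hTT'
  have hquot : h * (T' - T) / T ≤ h' * (1 - T / T') := by
    rw [one_sub_div hT'.ne', ← mul_div_assoc, div_le_div_iff₀ hT hT']
    nlinarith [mul_le_mul_of_nonneg_right hgrowth (sub_nonneg.2 hTT')]
  have hsqrt : √T / √T' ≤ 1 - (1 - T / T') / 2 := by
    have hsq : (√T / √T') ^ 2 = T / T' := by
      rw [div_pow, Real.sq_sqrt hT.le, Real.sq_sqrt hT'.le]
    linarith [two_mul_le_add_sq (√T / √T') 1]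
  have hvar : (α / √T') ^ 2 / 2 * (T' - T) = α ^ 2 * ((1 - T / T') / 2) := by
    rw [div_pow, Real.sq_sqrt hT'.le]
    field_simp
  have hκ : 0 ≤ 2 * h' + α ^ 2 := by positivity
  linarith [mul_le_mul_of_nonneg_right hsqrt hκ]

variable {E ι : Type*} {Λ : (E → ℝ) →ₗ[ℝ] ℝ} {φ : ι → E → ℝ} {r κ m : ℝ}

/-- The invariant of the Lyapunov argument: the functional `Λ`, which stands for the law of a
killed process, has mass at most `m`, and relative to `m` its exponential moments of order `r` in
the directions `φ k` are at most `exp κ`. -/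
def IsControlled (Λ : (E → ℝ) →ₗ[ℝ] ℝ) (φ : ι → E → ℝ) (r κ m : ℝ) : Prop :=
  Λ 1 ≤ m ∧ ∀ k, Λ (fun x => Real.exp (r * φ k x)) ≤ Real.exp κ * m

namespace IsControlled

theorem nonneg (hΛ : Monotone Λ) (h : IsControlled Λ φ r κ m) : 0 ≤ m :=
  (map_zero Λ).symm.le.trans ((hΛ zero_le_one).trans h.1)

theorem mono {m' : ℝ} (h : IsControlled Λ φ r κ m) (hm : m ≤ m') : IsControlled Λ φ r κ m' :=
  ⟨h.1.trans hm, fun k => (h.2 k).trans (by gcongr)⟩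

theorem exists_of_nonneg [Finite ι] (hΛ : Monotone Λ) (φ : ι → E → ℝ) (r : ℝ) (hκ : 0 ≤ κ) :
    ∃ m, IsControlled Λ φ r κ m := by
  cases nonempty_fintype ι
  have hexp : ∀ k, 0 ≤ Λ (fun x => Real.exp (r * φ k x)) := fun k =>
    (map_zero Λ).symm.le.trans (hΛ fun x => (Real.exp_pos _).le)
  have hone : 0 ≤ Λ 1 := (map_zero Λ).symm.le.trans (hΛ zero_le_one)
  have hsum : 0 ≤ ∑ k, Λ (fun x => Real.exp (r * φ k x)) := Finset.sum_nonneg fun k _ => hexp k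
  refine ⟨Λ 1 + ∑ k, Λ (fun x => Real.exp (r * φ k x)), le_add_of_nonneg_right hsum, fun k => ?_⟩
  calc Λ (fun x => Real.exp (r * φ k x)) ≤ ∑ k, Λ (fun x => Real.exp (r * φ k x)) :=
        Finset.single_le_sum (fun k _ => hexp k) (Finset.mem_univ k)
    _ ≤ Λ 1 + ∑ k, Λ (fun x => Real.exp (r * φ k x)) := le_add_of_nonneg_left hone
    _ ≤ _ := le_mul_of_one_le_left (add_nonneg hone hsum) (Real.one_le_exp hκ)

theorem apply_exp_mul_le (hΛ : Monotone Λ) (h : IsControlled Λ φ r κ m) {θ : ℝ}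
    (hθ : θ ∈ Set.Icc (0 : ℝ) 1) (k : ι) :
    Λ (fun x => Real.exp (θ * r * φ k x)) ≤ Real.exp (θ * κ) * m := by
  have hle : (fun x => Real.exp (θ * r * φ k x)) ≤ Real.exp (θ * κ) •
      ((θ * Real.exp (-κ)) • (fun x => Real.exp (r * φ k x)) + (1 - θ) • 1) := fun x => by
    simpa [mul_assoc] using exp_mul_le_of_mem_Icc hθ (r * φ k x) κ
  refine (hΛ hle).trans ?_
  simp only [map_smul, map_add, smul_eq_mul]
  refine mul_le_mul_of_nonneg_left ?_ (Real.exp_pos _).le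
  calc _ ≤ θ * Real.exp (-κ) * (Real.exp κ * m) + (1 - θ) * m :=
        add_le_add (mul_le_mul_of_nonneg_left (h.2 k) (mul_nonneg hθ.1 (Real.exp_pos _).le))
          (mul_le_mul_of_nonneg_left h.1 (sub_nonneg.2 hθ.2))
    _ = θ * (Real.exp (-κ) * Real.exp κ) * m + (1 - θ) * m := by ring
    _ = m := by rw [← Real.exp_add, neg_add_cancel, Real.exp_zero]; ring

theorem mass_le [Fintype ι] (hΛ : Monotone Λ) (h : IsControlled Λ φ r κ m) {M ρ b d : ℝ}
    (hρ : ρ ∈ Set.Icc (0 : ℝ) 1) (hd : d ≤ ρ * (1 - Fintype.card ι * Real.exp (κ - b)))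
    (hM : M ≤ (1 - ρ) * Λ 1 +
      ρ * (Real.exp (-b) * ∑ k, Λ (fun x => Real.exp (r * φ k x)))) :
    M ≤ Real.exp (-d) * m := by
  have hsum : Real.exp (-b) * ∑ k, Λ (fun x => Real.exp (r * φ k x)) ≤
      Fintype.card ι * Real.exp (κ - b) * m := by
    calc _ ≤ Real.exp (-b) * ∑ _k : ι, Real.exp κ * m := by
          gcongr with k
          exact h.2 k
      _ = _ := by
          rw [Finset.sum_const, Finset.card_univ, nsmul_eq_mul, sub_eq_add_neg, Real.exp_add κ]
          ring
  calc M ≤ (1 - ρ) * m + ρ * (Fintype.card ι * Real.exp (κ - b) * m) :=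
        hM.trans (add_le_add (mul_le_mul_of_nonneg_left h.1 (sub_nonneg.2 hρ.2))
          (mul_le_mul_of_nonneg_left hsum hρ.1))
    _ = (1 - ρ * (1 - Fintype.card ι * Real.exp (κ - b))) * m := by ring
    _ ≤ Real.exp (-d) * m := by
        gcongr
        · exact h.nonneg hΛ
        · linarith [Real.add_one_le_exp (-d)]

theorem apply_exp_rescaled_le {α h h' T T' M : ℝ} (hΛ : Monotone Λ)
    (hcontrol : IsControlled Λ φ (α / √T) (2 * h' + α ^ 2) m) (hT : 0 < T) (hTT' : T ≤ T')
    (hh' : 0 ≤ h') (hgrowth : h * T' ≤ h' * T) {k : ι}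
    (hM : M ≤ Real.exp ((α / √T') ^ 2 / 2 * (T' - T)) *
      Λ (fun x => Real.exp (α / √T' * φ k x))) :
    M ≤ Real.exp (2 * h' + α ^ 2 - h * (T' - T) / T) * m := by
  have hr : α / √T' = √T / √T' * (α / √T) := by
    have := Real.sqrt_pos.2 hT
    field_simp
  have hθ : √T / √T' ∈ Set.Icc (0 : ℝ) 1 :=
    ⟨by positivity, div_le_one_of_le₀ (Real.sqrt_le_sqrt hTT') (Real.sqrt_nonneg _)⟩
  have hinterp := hcontrol.apply_exp_mul_le hΛ hθ k
  rw [← hr] at hinterp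
  calc M ≤ Real.exp ((α / √T') ^ 2 / 2 * (T' - T)) *
        (Real.exp (√T / √T' * (2 * h' + α ^ 2)) * m) := hM.trans (by gcongr)
    _ ≤ Real.exp (2 * h' + α ^ 2 - h * (T' - T) / T) * m := by
        rw [← mul_assoc, ← Real.exp_add]
        gcongr
        · exact hcontrol.nonneg hΛ
        · exact rescaled_exponent_le hT hTT' hh' hgrowth

end IsControlled

theorem exists_mass_le_rpow [Fintype ι] {Λ : ℕ → (E → ℝ) →ₗ[ℝ] ℝ} (hΛ : ∀ i, Monotone (Λ i))
    {T : ℕ → ℝ} (hT : ∀ i, 0 < T i) (hTmono : Monotone T) {α b h h' : ℝ} (hh : 0 ≤ h)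
    (hgrowth : ∀ᶠ i in atTop, h * T (i + 1) ≤ h' * T i)
    (hexp : ∀ᶠ i in atTop, ∀ k, Λ (i + 1) (fun x => Real.exp (α / √(T (i + 1)) * φ k x)) ≤
      Real.exp ((α / √(T (i + 1))) ^ 2 / 2 * (T (i + 1) - T i)) *
        Λ i (fun x => Real.exp (α / √(T (i + 1)) * φ k x)))
    (hmass : ∀ᶠ i in atTop, ∃ ρ ∈ Set.Icc (0 : ℝ) 1,
      h * (T (i + 1) - T i) ≤ ρ * (1 - Fintype.card ι * Real.exp (2 * h' + α ^ 2 - b)) * T i ∧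
      Λ (i + 1) 1 ≤ (1 - ρ) * Λ i 1 +
        ρ * (Real.exp (-b) * ∑ k, Λ i (fun x => Real.exp (α / √(T i) * φ k x)))) :
    ∃ C, ∀ᶠ i in atTop, Λ i 1 ≤ C * T i ^ (-h) := by
  obtain ⟨i₀, hi₀⟩ := eventually_atTop.1 (hgrowth.and (hexp.and hmass))
  have hh' : 0 ≤ h' := nonneg_of_mul_nonneg_left
    ((mul_nonneg hh (hT _).le).trans (hi₀ i₀ le_rfl).1) (hT i₀)
  -- To first order in `u = (T (i + 1) - T i) / T i`, rescaling the moments multiplies `κ` by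
  -- `1 - u / 2`, the variance adds `α ^ 2 * u / 2` and the mass bound loses `h * u`: this balances
  -- at `κ = 2 * h + α ^ 2`, and `h' > h` absorbs the terms of higher order.
  set κ := 2 * h' + α ^ 2
  have hκ : 0 ≤ κ := by positivity
  obtain ⟨m, hm⟩ := IsControlled.exists_of_nonneg (hΛ i₀) φ (α / √(T i₀)) hκ
  have hC : m = m * T i₀ ^ h * T i₀ ^ (-h) := by
    rw [mul_assoc, ← Real.rpow_add (hT _), add_neg_cancel, Real.rpow_zero, mul_one]
  suffices hcontrol : ∀ i ≥ i₀,
      IsControlled (Λ i) φ (α / √(T i)) κ (m * T i₀ ^ h * T i ^ (-h)) from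
    ⟨m * T i₀ ^ h, eventually_atTop.2 ⟨i₀, fun i hi => (hcontrol i hi).1⟩⟩
  refine Nat.le_induction (hm.mono hC.le) fun i hi ih => ?_
  obtain ⟨hgrowth, hexp, ρ, hρ, hd, hmass⟩ := hi₀ i hi
  set C := m * T i₀ ^ h
  have hdecay : Real.exp (-(h * (T (i + 1) - T i) / T i)) * (C * T i ^ (-h)) ≤
      C * T (i + 1) ^ (-h) := by
    have hC0 : 0 ≤ C := mul_nonneg (hm.nonneg (hΛ i₀)) (Real.rpow_nonneg (hT i₀).le h)
    rw [mul_comm, mul_assoc]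
    exact mul_le_mul_of_nonneg_left (rpow_neg_mul_exp_le (hT i) (hT (i + 1)) hh) hC0
  refine ⟨(ih.mass_le (hΛ i) hρ ((div_le_iff₀ (hT i)).2 hd) hmass).trans hdecay, fun k => ?_⟩
  calc _ ≤ Real.exp (κ - h * (T (i + 1) - T i) / T i) * (C * T i ^ (-h)) :=
        ih.apply_exp_rescaled_le (hΛ i) (hT i) (hTmono i.le_succ) hh' hgrowth (hexp k)
    _ ≤ Real.exp κ * (C * T (i + 1) ^ (-h)) := by
        rw [sub_eq_add_neg, Real.exp_add, mul_assoc]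
        gcongr

end PolynomialDecay

/-- The coordinate `x ↦ ±x.1` or `x ↦ ±x.2`; the first flag says whether it is the horizontal one,
the second one whether it has a positive sign. -/
def dirCoord (k : Bool × Bool) : ℤ × ℤ →+ ℝ :=
  if k.1 then (if k.2 then fstCoord else -fstCoord) else (if k.2 then sndCoord else -sndCoord)

theorem isCoordinate_dirCoord : ∀ k, IsCoordinate (dirCoord k)
  | (true, true) => isCoordinate_fstCoord
  | (true, false) => isCoordinate_fstCoord.neg
  | (false, true) => isCoordinate_sndCoord
  | (false, false) => isCoordinate_sndCoord.neg

theorem exists_dirCoord_ge {a : Bool → ℝ} {x : ℤ × ℤ}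
    (h : ¬ (|(x.1 : ℝ)| ≤ a true ∧ |(x.2 : ℝ)| ≤ a false)) : ∃ k, a k.1 ≤ dirCoord k x := by
  rw [not_and_or, not_le, not_le, lt_abs, lt_abs] at h
  rcases h with (h | h) | (h | h)
  exacts [⟨(true, true), h.le⟩, ⟨(true, false), h.le⟩, ⟨(false, true), h.le⟩,
    ⟨(false, false), h.le⟩]

namespace SweepParams

open Filter Topology

variable {P : SweepParams} {p : ℝ} {home : ℤ × ℤ}

theorem eventually_phaseOp_exp_dirCoord_le (hp : p ∈ Set.Icc (0 : ℝ) 1) (hP : P.p₀ < 1)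
    (hA : 0 < P.A) (hB : 0 < P.B) {σ : Bool → ℝ} (hσh : stepVar p 1 < σ true ^ 2)
    (hσv : stepVar p 0 < σ false ^ 2) (home : ℤ × ℤ) (k : Bool × Bool) :
    ∀ᶠ rt : ℝ × ℕ in 𝓝 0 ×ˢ atTop, ∀ x,
      P.phaseOp p home rt.2 (fun y => Real.exp (rt.1 * dirCoord k y)) x ≤
        Real.exp (rt.1 ^ 2 / 2 * (σ k.1 ^ 2 * P.duration rt.2)) *
          Real.exp (rt.1 * dirCoord k x) := by
  have hmono : stepVar p 0 ≤ stepVar p 1 := by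
    have := mul_nonneg hp.1 (sub_nonneg.2 hp.2)
    simp only [stepVar]
    linarith
  obtain ⟨horizontal, positive⟩ := k
  cases horizontal
  · obtain ⟨v, hpv, hvσ⟩ := exists_between hσv
    have hpos : 0 ≤ stepVar p 0 := by simpa [stepVar] using div_nonneg hp.1 zero_le_two
    have hcost : ∀ᶠ t : ℕ in atTop, (2 * P.W t * (P.N t + 1)) * v +
        (2 * ((P.N t - 1) * P.G t) + 2 * P.M t) * 2 ≤ σ false ^ 2 * P.duration t := by
      filter_upwards [eventually_vertical_le hP hA hB (ε := (σ false ^ 2 - v) / 2) (by linarith),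
        eventually_ge_atTop 2] with t hvert ht
      have hG := G_pos hP ht
      have hH := H_pos hP hB ht
      have hN : (1 : ℝ) ≤ P.N t := by exact_mod_cast N_pos hG hH
      have hnonneg : 0 ≤ 2 * (((P.N t : ℝ) - 1) * P.G t) + 2 * P.M t := by
        have := sub_nonneg.2 hN
        positivity
      have hhoriz : (2 * P.W t * (P.N t + 1) : ℝ) * v ≤ P.duration t * v :=
        mul_le_mul_of_nonneg_right (by linarith [duration_eq hG hH]) (hpos.trans hpv.le)
      linarith
    have hlt : stepVar p 1 < 2 := (stepVar_le_one hp (by norm_num)).trans_lt one_lt_two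
    cases positive <;> exact eventually_phaseOp_exp_le hp hP hB (isCoordinate_dirCoord _)
      (by simpa [dirCoord, stepVar] using hpv) (by simpa [dirCoord, stepVar] using hlt) hcost home
  · have hcost : ∀ᶠ t : ℕ in atTop, (2 * P.W t * (P.N t + 1)) * σ true ^ 2 +
        (2 * ((P.N t - 1) * P.G t) + 2 * P.M t) * σ true ^ 2 ≤ σ true ^ 2 * P.duration t := by
      filter_upwards [eventually_ge_atTop 2] with t ht
      rw [duration_eq (G_pos hP ht) (H_pos hP hB ht)]
      linarith
    have hlt := hmono.trans_lt hσh
    cases positive <;> exact eventually_phaseOp_exp_le hp hP hB (isCoordinate_dirCoord _)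
      (by simpa [dirCoord, stepVar] using hσh) (by simpa [dirCoord, stepVar] using hlt) hcost home

theorem phaseOp_one_le_exp (hp : p ∈ Set.Icc (0 : ℝ) 1) {t : ℕ} (ht : 1 ≤ t) {σ : Bool → ℝ}
    (hσ : ∀ j, 0 < σ j) {b ρ : ℝ} (hb : 0 ≤ b) (hρ : 0 ≤ ρ)
    (hbox : ∀ x : ℤ × ℤ, |(x.1 : ℝ)| ≤ b * σ true * √(t : ℝ) →
      |(x.2 : ℝ)| ≤ b * σ false * √(t : ℝ) → P.phaseOp p home t 1 x ≤ 1 - ρ) :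
    P.phaseOp p home t 1 ≤ (1 - ρ) • 1 + ρ • (Real.exp (-(b ^ 2 / 2)) •
      ∑ k, fun x => Real.exp (b / 2 / √(t : ℝ) * (dirCoord k x / σ k.1))) := by
  intro x
  simp only [Pi.add_apply, Pi.smul_apply, Pi.one_apply, Finset.sum_apply, smul_eq_mul, mul_one]
  by_cases hin : |(x.1 : ℝ)| ≤ b * σ true * √(t : ℝ) ∧ |(x.2 : ℝ)| ≤ b * σ false * √(t : ℝ)
  · exact (hbox x hin.1 hin.2).trans (le_add_of_nonneg_right (by positivity))
  obtain ⟨k, hk⟩ := exists_dirCoord_ge (a := fun j => b * σ j * √(t : ℝ)) hin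
  have : 0 < √(t : ℝ) := Real.sqrt_pos.2 (by exact_mod_cast ht)
  have hexp : 1 ≤ Real.exp (-(b ^ 2 / 2)) *
      Real.exp (b / 2 / √(t : ℝ) * (dirCoord k x / σ k.1)) := by
    rw [← Real.exp_add]
    refine Real.one_le_exp ?_
    have hb2 : b ^ 2 / 2 = b / 2 / √(t : ℝ) * (b * √(t : ℝ)) := by field_simp
    have hscaled : b * √(t : ℝ) ≤ dirCoord k x / σ k.1 := by
      rw [le_div_iff₀ (hσ _), mul_right_comm]
      exact hk
    rw [neg_add_eq_sub, sub_nonneg, hb2]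
    gcongr
  have hsum := hexp.trans (mul_le_mul_of_nonneg_left (Finset.single_le_sum
    (f := fun k => Real.exp (b / 2 / √(t : ℝ) * (dirCoord k x / σ k.1)))
    (fun k _ => (Real.exp_pos _).le) (Finset.mem_univ k)) (Real.exp_pos _).le)
  linarith [phaseOp_one_le_one (P := P) (home := home) hp ht x, mul_le_mul_of_nonneg_left hsum hρ]

theorem startTime_succ (i : ℕ) :
    P.startTime (i + 1) = P.startTime i + P.duration (P.startTime i) := rfl

theorem one_le_duration {t : ℕ} (ht : 1 ≤ t) : 1 ≤ P.duration t := by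
  have := P.one_le_M ht
  simp only [duration, phase, List.length_append, List.length_replicate]
  omega

theorem strictMono_startTime (P : SweepParams) : StrictMono P.startTime :=
  strictMono_nat_of_lt_succ fun i =>
    Nat.lt_add_of_pos_right (one_le_duration (one_le_two.trans (P.two_le_startTime i)))

/-- The functional `f ↦ 𝔼[f (X t); t < T]` for the guided random walk `X` that follows the sweeping
strategy and hits `home` at time `T`, where `t` is the start time of the `i`-th phase. -/
noncomputable def survFunctional (P : SweepParams) (p : ℝ) (home : ℤ × ℤ) :
    ℕ → (ℤ × ℤ → ℝ) →ₗ[ℝ] ℝ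
  | 0 => LinearMap.proj 0 ∘ₗ survOp p home [(1, 0), (-1, 0)]
  | i + 1 => survFunctional P p home i ∘ₗ P.phaseOp p home (P.startTime i)

theorem survFunctional_succ (i : ℕ) (f : ℤ × ℤ → ℝ) : P.survFunctional p home (i + 1) f =
    P.survFunctional p home i (P.phaseOp p home (P.startTime i) f) := rfl

theorem survFunctional_mono (hp : p ∈ Set.Icc (0 : ℝ) 1) :
    ∀ i, Monotone (P.survFunctional p home i)
  | 0 => fun _ _ h => survOp_mono hp [(1, 0), (-1, 0)] h 0
  | i + 1 => (survFunctional_mono hp i).comp (phaseOp_mono hp _)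

theorem eventually_survFunctional_exp_le (hp : p ∈ Set.Icc (0 : ℝ) 1) (hP : P.p₀ < 1)
    (hA : 0 < P.A) (hB : 0 < P.B) {σ : Bool → ℝ} (hσ : ∀ j, 0 < σ j)
    (hσh : stepVar p 1 < σ true ^ 2) (hσv : stepVar p 0 < σ false ^ 2) (home : ℤ × ℤ) (α : ℝ) :
    ∀ᶠ i in atTop, ∀ k, P.survFunctional p home (i + 1) (fun x =>
        Real.exp (α / √(P.startTime (i + 1) : ℝ) * (dirCoord k x / σ k.1))) ≤
      Real.exp ((α / √(P.startTime (i + 1) : ℝ)) ^ 2 / 2 *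
          ((P.startTime (i + 1) : ℝ) - P.startTime i)) *
        P.survFunctional p home i (fun x =>
          Real.exp (α / √(P.startTime (i + 1) : ℝ) * (dirCoord k x / σ k.1))) := by
  have hT := P.strictMono_startTime.tendsto_atTop
  have hr : Tendsto (fun i => α / √(P.startTime (i + 1) : ℝ)) atTop (𝓝 0) :=
    ((tendsto_sqrt_natCast.comp hT).comp (tendsto_add_atTop_nat 1)).const_div_atTop α
  refine eventually_all.2 fun k => ?_
  have hrσ := hr.div_const (σ k.1)
  rw [zero_div] at hrσ
  filter_upwards [(hrσ.prodMk hT).eventually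
    (eventually_phaseOp_exp_dirCoord_le hp hP hA hB hσh hσv home k)] with i hi
  set r := α / √(P.startTime (i + 1) : ℝ)
  have hscale : ∀ x, r / σ k.1 * dirCoord k x = r * (dirCoord k x / σ k.1) := fun x => by ring
  have hvar : (r / σ k.1) ^ 2 / 2 * (σ k.1 ^ 2 * P.duration (P.startTime i)) =
      r ^ 2 / 2 * ((P.startTime (i + 1) : ℝ) - P.startTime i) := by
    have := hσ k.1
    rw [startTime_succ, Nat.cast_add, add_sub_cancel_left]
    field_simp
  simp only [hscale, hvar] at hi
  rw [survFunctional_succ]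
  exact (survFunctional_mono hp i hi).trans_eq (map_smul (P.survFunctional p home i) _ _)

theorem eventually_survFunctional_one_le (hp0 : 0 ≤ p) (hp : p < P.p₀) (hP : P.p₀ < 1)
    {σ : Bool → ℝ} (hσ : ∀ j, 0 < σ j) {b : ℝ} (hb : 0 < b) (hA : P.A = b * σ true)
    (hB : P.B = b * σ false) {h δ q ε : ℝ} (hh : 0 ≤ h) (hε : ε ∈ Set.Ioo (0 : ℝ) 1)
    (hq : 4 * (P.A / (1 - P.p₀)) * (P.B / (1 - P.p₀)) < q) (hhq : h * q ≤ (1 - ε) * δ)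
    (home : ℤ × ℤ) :
    ∀ᶠ i in atTop, ∃ ρ ∈ Set.Icc (0 : ℝ) 1,
      h * ((P.startTime (i + 1) : ℝ) - P.startTime i) ≤ ρ * δ * P.startTime i ∧
      P.survFunctional p home (i + 1) 1 ≤ (1 - ρ) * P.survFunctional p home i 1 +
        ρ * (Real.exp (-(b ^ 2 / 2)) * ∑ k, P.survFunctional p home i (fun x =>
          Real.exp (b / 2 / √(P.startTime i : ℝ) * (dirCoord k x / σ k.1)))) := by
  have hpI : p ∈ Set.Icc (0 : ℝ) 1 := ⟨hp0, (hp.trans hP).le⟩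
  have hA0 : 0 < P.A := hA ▸ mul_pos hb (hσ _)
  have hB0 : 0 < P.B := hB ▸ mul_pos hb (hσ _)
  have hT := P.strictMono_startTime.tendsto_atTop
  filter_upwards [hT.eventually (eventually_phaseOp_one_le hp0 hp hP hA0 hB0 home hε.1),
    hT.eventually (eventually_duration_mul_M_le hP hA0 hB0 hq)] with i hbox hDM
  set t := P.startTime i with ht
  have ht1 : 1 ≤ t := one_le_two.trans (P.two_le_startTime i)
  have hM : (1 : ℝ) ≤ P.M t := by exact_mod_cast P.one_le_M ht1
  have hMpos : (0 : ℝ) < P.M t := one_pos.trans_le hM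
  have hρ : 0 ≤ (1 - ε) / P.M t := div_nonneg (sub_nonneg.2 hε.2.le) hMpos.le
  refine ⟨(1 - ε) / P.M t, ⟨hρ, (div_le_one hMpos).2 (by linarith [hε.1])⟩, ?_, ?_⟩
  · rw [startTime_succ, ← ht, Nat.cast_add, add_sub_cancel_left, div_mul_eq_mul_div,
      div_mul_eq_mul_div, le_div_iff₀ hMpos]
    calc h * (P.duration t : ℝ) * P.M t = h * (P.duration t * P.M t) := by ring
      _ ≤ h * (q * t) := by gcongr
      _ = h * q * t := by ring
      _ ≤ (1 - ε) * δ * t := by gcongr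
  · rw [hA, hB] at hbox
    have hle := survFunctional_mono (P := P) (home := home) hpI i
      (phaseOp_one_le_exp hpI ht1 hσ hb.le hρ hbox)
    simpa only [survFunctional_succ, ← ht, map_add, map_smul, map_sum, smul_eq_mul] using hle

theorem exists_growth_margin {q s : ℝ} (hq : q < 1 - 4 * Real.exp (2 - s)) :
    ∃ ε ∈ Set.Ioo (0 : ℝ) 1,
      (1 + ε) * (q + ε) ≤ (1 - ε) * (1 - 4 * Real.exp (2 * (1 + 2 * ε) - s)) := by
  have hlim : ∀ᶠ ε in 𝓝 (0 : ℝ),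
      (1 + ε) * (q + ε) < (1 - ε) * (1 - 4 * Real.exp (2 * (1 + 2 * ε) - s)) :=
    (by fun_prop : Continuous fun ε : ℝ => (1 + ε) * (q + ε)).continuousAt.eventually_lt
      (by fun_prop : Continuous fun ε : ℝ =>
        (1 - ε) * (1 - 4 * Real.exp (2 * (1 + 2 * ε) - s))).continuousAt (by simpa using hq)
  obtain ⟨ε, hε, hle⟩ := ((eventually_of_mem (Ioo_mem_nhdsGT one_pos)
    fun _ h => h).and (nhdsWithin_le_nhds hlim)).exists
  exact ⟨ε, hε, hle.le⟩

theorem exists_survFunctional_le_of_lt (hp0 : 0 ≤ p) (hp : p < P.p₀) (hP : P.p₀ < 1)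
    {σ : Bool → ℝ} (hσ : ∀ j, 0 < σ j) {b : ℝ} (hb : 0 < b) (hA : P.A = b * σ true)
    (hB : P.B = b * σ false) (hσh : stepVar p 1 < σ true ^ 2) (hσv : stepVar p 0 < σ false ^ 2)
    (hAB : 4 * (P.A / (1 - P.p₀)) * (P.B / (1 - P.p₀)) < 1 - 4 * Real.exp (2 - b ^ 2 / 4))
    (home : ℤ × ℤ) :
    ∃ h : ℝ, 1 < h ∧ ∃ C : ℝ, ∀ᶠ i in atTop,
      P.survFunctional p home i 1 ≤ C * (P.startTime i : ℝ) ^ (-h) := by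
  have hpI : p ∈ Set.Icc (0 : ℝ) 1 := ⟨hp0, (hp.trans hP).le⟩
  have hA0 : 0 < P.A := hA ▸ mul_pos hb (hσ _)
  have hB0 : 0 < P.B := hB ▸ mul_pos hb (hσ _)
  have hT := P.strictMono_startTime
  obtain ⟨ε, hε, hmargin⟩ := exists_growth_margin hAB
  have hh : 0 < 1 + ε := by linarith [hε.1]
  refine ⟨1 + ε, by linarith [hε.1], exists_mass_le_rpow (h' := 1 + 2 * ε) (α := b / 2)
    (b := b ^ 2 / 2) (survFunctional_mono hpI) (fun i => ?_) (Nat.mono_cast.comp hT.monotone) hh.le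
    ?_ (eventually_survFunctional_exp_le hpI hP hA0 hB0 hσ hσh hσv home (b / 2)) ?_⟩
  · exact Nat.cast_pos.2 (two_pos.trans_le (P.two_le_startTime i))
  · filter_upwards [hT.tendsto_atTop.eventually
      (eventually_duration_le hP hA0 hB0 (div_pos hε.1 hh))] with i hi
    rw [div_mul_eq_mul_div, le_div_iff₀ hh] at hi
    simp only [Function.comp_apply, startTime_succ, Nat.cast_add]
    linarith
  · refine eventually_survFunctional_one_le hp0 hp hP hσ hb hA hB hh.le hε
      (lt_add_of_pos_right _ hε.1) (hmargin.trans_eq ?_) home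
    have hcard : (Fintype.card (Bool × Bool) : ℝ) = 4 := by simp
    have hexponent : 2 * (1 + 2 * ε) + (b / 2) ^ 2 - b ^ 2 / 2 = 2 * (1 + 2 * ε) - b ^ 2 / 4 := by
      ring
    rw [hcard, hexponent]

theorem exists_scale_of_lt {v₁ v₂ c₁ c₂ : ℝ} (h₁ : v₁ < c₁) (h₂ : v₂ < c₂) :
    ∃ τ ∈ Set.Ioo (0 : ℝ) 1, v₁ < τ ^ 2 * c₁ ∧ v₂ < τ ^ 2 * c₂ := by
  have hlim : ∀ {v c : ℝ}, v < c → ∀ᶠ τ in 𝓝 (1 : ℝ), v < τ ^ 2 * c := fun h =>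
    continuousAt_const.eventually_lt
      (by fun_prop : Continuous fun τ : ℝ => τ ^ 2 * _).continuousAt (by simpa using h)
  obtain ⟨τ, hτ, h₁τ, h₂τ⟩ := ((eventually_of_mem (Ioo_mem_nhdsLT one_pos) fun _ h => h).and
    (nhdsWithin_le_nhds ((hlim h₁).and (hlim h₂)))).exists
  exact ⟨τ, hτ, h₁τ, h₂τ⟩

theorem exists_survFunctional_le {a : ℝ} (ha : 0 < a) (hp0 : 0 ≤ p) (hp : p < P.p₀)
    (hP : P.p₀ ≤ 3 / 4) (hA : P.A = a * √(P.p₀ / 2 * (3 - 2 * P.p₀))) (hB : P.B = a * √(P.p₀ / 2))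
    (hAB : 4 * (P.A / (1 - P.p₀)) * (P.B / (1 - P.p₀)) ≤ 1 - 4 * Real.exp (2 - a ^ 2 / 4))
    (home : ℤ × ℤ) :
    ∃ h : ℝ, 1 < h ∧ ∃ C : ℝ, ∀ᶠ i in atTop,
      P.survFunctional p home i 1 ≤ C * (P.startTime i : ℝ) ^ (-h) := by
  set c : Bool → ℝ := fun horizontal =>
    if horizontal then P.p₀ / 2 * (3 - 2 * P.p₀) else P.p₀ / 2
  have hc : ∀ j, 0 < c j := Bool.forall_bool.2
    ⟨half_pos (hp0.trans_lt hp), mul_pos (half_pos (hp0.trans_lt hp)) (by linarith)⟩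
  have hvar : stepVar p 1 < c true ∧ stepVar p 0 < c false := by
    constructor <;> simp only [stepVar, c, if_true, Bool.false_eq_true, if_false] <;> nlinarith
  obtain ⟨τ, ⟨hτ0, hτ1⟩, hτh, hτv⟩ := exists_scale_of_lt hvar.1 hvar.2
  have hsq : ∀ j, (τ * √(c j)) ^ 2 = τ ^ 2 * c j := fun j => by
    rw [mul_pow, Real.sq_sqrt (hc j).le]
  have hscale : ∀ j, a * √(c j) = a / τ * (τ * √(c j)) := fun j => by field_simp
  have hlt : a < a / τ := by rwa [lt_div_iff₀ hτ0, mul_lt_iff_lt_one_right ha]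
  refine exists_survFunctional_le_of_lt hp0 hp (by linarith)
    (σ := fun j => τ * √(c j)) (fun j => mul_pos hτ0 (Real.sqrt_pos.2 (hc j)))
    (div_pos ha hτ0) (hA.trans (hscale true)) (hB.trans (hscale false))
    (by rwa [hsq]) (by rwa [hsq]) (hAB.trans_lt ?_) home
  gcongr

end SweepParams

/-! ### The law of the guided random walk -/

section DiscreteProduct

variable {ι : Type*} {X : ι → Type*} [∀ i, MeasurableSpace (X i)] [∀ i, Countable (X i)]
  [∀ i, MeasurableSingletonClass (X i)]

theorem measurable_of_dependsOn {β : Type*} [MeasurableSpace β] [Nonempty β] {s : Finset ι}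
    {f : (∀ i, X i) → β} (hf : DependsOn f s) : Measurable f := by
  obtain ⟨g, rfl⟩ := dependsOn_iff_exists_comp.1 hf
  exact Measurable.of_discrete.comp (Finset.measurable_restrict s)

theorem lintegral_infinitePi_eval (μ : ∀ i, Measure (X i)) [∀ i, IsProbabilityMeasure (μ i)]
    {s : Finset ι} {i : ι} (hi : i ∉ s) {F : (∀ i, X i) → X i → ℝ≥0∞} (hF : DependsOn F s) :
    ∫⁻ ω, F ω (ω i) ∂(Measure.infinitePi μ) =
      ∫⁻ ω, ∫⁻ e, F ω e ∂(μ i) ∂(Measure.infinitePi μ) := by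
  obtain ⟨g, rfl⟩ := dependsOn_iff_exists_comp.1 hF
  have hrestrict : Measurable s.restrict := Finset.measurable_restrict (X := X) s
  have hcoords : iIndepFun (fun j (ω : ∀ j, X j) => ω j) (Measure.infinitePi μ) :=
    iIndepFun_infinitePi (X := fun _ x => x) fun _ => measurable_id
  have hind : IndepFun s.restrict (fun ω : ∀ j, X j => ω i) (Measure.infinitePi μ) :=
    (hcoords.indepFun_finset s {i} (Finset.disjoint_singleton_right.2 hi)
      measurable_pi_apply).comp (φ := id) (ψ := fun y : ∀ j : ({i} : Finset ι), X j =>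
        y ⟨i, Finset.mem_singleton_self i⟩) measurable_id (measurable_pi_apply _)
  have hprod := hind.map_prod_eq_prod_map_map hrestrict.aemeasurable
    (measurable_pi_apply i).aemeasurable
  rw [Measure.infinitePi_map_eval] at hprod
  calc ∫⁻ ω, g (s.restrict ω) (ω i) ∂(Measure.infinitePi μ)
      = ∫⁻ q, g q.1 q.2 ∂((Measure.infinitePi μ).map fun ω => (s.restrict ω, ω i)) :=
        (lintegral_map (f := fun q : (∀ j : s, X j) × X i => g q.1 q.2) Measurable.of_discrete
          (hrestrict.prodMk (measurable_pi_apply i))).symm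
    _ = ∫⁻ y, ∫⁻ e, g y e ∂(μ i) ∂((Measure.infinitePi μ).map s.restrict) := by
        rw [hprod, lintegral_prod _ Measurable.of_discrete.aemeasurable]
    _ = ∫⁻ ω, ∫⁻ e, g (s.restrict ω) e ∂(μ i) ∂(Measure.infinitePi μ) :=
        lintegral_map Measurable.of_discrete hrestrict

end DiscreteProduct

theorem lintegral_uniformOn_finset {E : Type*} [MeasurableSpace E] [MeasurableSingletonClass E]
    (s : Finset E) (f : E → ℝ≥0∞) :
    ∫⁻ x, f x ∂(uniformOn (s : Set E)) = (s.card : ℝ≥0∞)⁻¹ * ∑ x ∈ s, f x := by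
  rw [uniformOn, ProbabilityTheory.cond, lintegral_smul_measure, lintegral_finset]
  simp

theorem lintegral_stepNoiseLaw (p : unitInterval) (f : Bool × (ℤ × ℤ) → ℝ≥0∞) :
    ∫⁻ e, f e ∂(stepNoiseLaw p) = ENNReal.ofReal p * (4⁻¹ * ∑ s ∈ unitSteps, f (true, s)) +
      ENNReal.ofReal (1 - p) * (4⁻¹ * ∑ s ∈ unitSteps, f (false, s)) := by
  have : IsProbabilityMeasure (uniformOn (unitSteps : Set (ℤ × ℤ))) :=
    isProbabilityMeasure_uniformOn unitSteps.finite_toSet ⟨(1, 0), by simp [unitSteps]⟩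
  rw [stepNoiseLaw, lintegral_prod _ Measurable.of_discrete.aemeasurable]
  simp only [lintegral_uniformOn_finset, card_unitSteps, bernoulliMeasure_def]
  rw [lintegral_add_measure, lintegral_smul_measure, lintegral_smul_measure, lintegral_dirac,
    lintegral_dirac, ENNReal.smul_def, ENNReal.smul_def, smul_eq_mul, smul_eq_mul,
    ENNReal.ofReal_eq_coe_nnreal p.2.1, ENNReal.ofReal_eq_coe_nnreal (sub_nonneg.2 p.2.2)]
  rfl

theorem lintegral_stepNoiseLaw_step (p : unitInterval) {k : ℤ × ℤ → ℝ} (hk : ∀ y, 0 ≤ k y)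
    (d : ℤ × ℤ) :
    ∫⁻ e, ENNReal.ofReal (k (if e.1 then e.2 else d)) ∂(stepNoiseLaw p) =
      ENNReal.ofReal (stepMean p d k) := by
  have hp0 : (0 : ℝ) ≤ p := p.2.1
  have hp1 : (0 : ℝ) ≤ 1 - p := sub_nonneg.2 p.2.2
  have hsum : 0 ≤ ∑ s ∈ unitSteps, k s := Finset.sum_nonneg fun s _ => hk s
  have hfour : (4 : ℝ≥0∞)⁻¹ = ENNReal.ofReal 4⁻¹ := by
    rw [ENNReal.ofReal_inv_of_pos four_pos, ENNReal.ofReal_ofNat]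
  have hconst : (4 : ℝ≥0∞)⁻¹ * ∑ _s ∈ unitSteps, ENNReal.ofReal (k d) = ENNReal.ofReal (k d) := by
    rw [Finset.sum_const, card_unitSteps, nsmul_eq_mul, ← mul_assoc, Nat.cast_ofNat,
      ENNReal.inv_mul_cancel (by simp) (by simp), one_mul]
  rw [lintegral_stepNoiseLaw, stepMean_apply]
  simp only [if_true, Bool.false_eq_true, if_false]
  rw [hconst, ← ENNReal.ofReal_sum_of_nonneg fun s _ => hk s, hfour,
    ← ENNReal.ofReal_mul (by norm_num), ← ENNReal.ofReal_mul hp0, ← ENNReal.ofReal_mul hp1,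
    ← ENNReal.ofReal_add (by positivity) (mul_nonneg hp1 (hk d))]
  congr 1
  ring

theorem measurable_guidedWalk {Ω : Type*} [MeasurableSpace Ω] {x : Ω → ℕ → ℤ × ℤ}
    {ω : Ω → ℕ → Bool × (ℤ × ℤ)} (hx : ∀ t, Measurable fun q => x q t)
    (hω : ∀ t, Measurable fun q => ω q t) : ∀ t, Measurable fun q => guidedWalk (x q) (ω q) t
  | 0 => measurable_const
  | t + 1 => (measurable_guidedWalk hx hω t).add <| Measurable.ite
      ((hω t).fst (MeasurableSet.singleton true)) (hω t).snd ((hx (t + 1)).sub (hx t))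

theorem dependsOn_guidedWalk (x : ℕ → ℤ × ℤ) :
    ∀ t, DependsOn (fun ω => guidedWalk x ω t) (Finset.range t : Set ℕ)
  | 0 => fun _ _ _ => rfl
  | t + 1 => fun ω ω' h => by
    have ih := dependsOn_guidedWalk x t fun i hi => h i (Finset.range_mono t.le_succ hi)
    simp only [guidedWalk, ih, h t (Finset.self_mem_range_succ t)]

/-- The indicator of the event that the path `X` does not visit `home` at the times `1, …, n`;
the time `0` is excluded, just as in `aliveInd`. -/
def avoidInd (home : ℤ × ℤ) (X : ℕ → ℤ × ℤ) (n : ℕ) : ℝ :=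
  ∏ t ∈ Finset.range n, if X (t + 1) = home then 0 else 1

section Avoid

variable {home : ℤ × ℤ}

theorem avoidInd_nonneg (X : ℕ → ℤ × ℤ) (n : ℕ) : 0 ≤ avoidInd home X n :=
  Finset.prod_nonneg fun _ _ => ite_nonneg le_rfl zero_le_one

theorem avoidInd_succ_mul (X : ℕ → ℤ × ℤ) (n : ℕ) (r : ℝ) : avoidInd home X (n + 1) * r =
    avoidInd home X n * if X (n + 1) = home then 0 else r := by
  rw [avoidInd, Finset.prod_range_succ, ← avoidInd, mul_assoc, ite_mul, zero_mul, one_mul]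

theorem avoidInd_antitone (X : ℕ → ℤ × ℤ) : Antitone (avoidInd home X) :=
  antitone_nat_of_succ_le fun n => by
    rw [← mul_one (avoidInd home X (n + 1)), avoidInd_succ_mul]
    refine mul_le_of_le_one_right (avoidInd_nonneg _ _) ?_
    split_ifs
    exacts [zero_le_one, le_rfl]

theorem dependsOn_avoidInd (n : ℕ) :
    DependsOn (fun X => avoidInd home X n) (Finset.range (n + 1) : Set ℕ) := fun X X' h =>
  Finset.prod_congr rfl fun t ht => by
    rw [h (t + 1) (by simpa using ht)]

theorem measurable_avoidInd {Ω : Type*} [MeasurableSpace Ω] {X : Ω → ℕ → ℤ × ℤ}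
    (hX : ∀ t, Measurable fun q => X q t) (n : ℕ) : Measurable fun q => avoidInd home (X q) n :=
  Finset.measurable_prod _ fun t _ => Measurable.ite
    (hX (t + 1) (MeasurableSet.singleton home)) measurable_const measurable_const

theorem survOp_nonneg {p : ℝ} (hp : p ∈ Set.Icc (0 : ℝ) 1) (l : List (ℤ × ℤ))
    {f : ℤ × ℤ → ℝ} (hf : 0 ≤ f) : 0 ≤ survOp p home l f := by
  simpa using survOp_mono (home := home) hp l hf

theorem lintegral_noiseLaw_avoidInd_succ (p : unitInterval) (x : ℕ → ℤ × ℤ) (n : ℕ)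
    {f : ℤ × ℤ → ℝ} (hf : 0 ≤ f) :
    ∫⁻ ω, ENNReal.ofReal (avoidInd home (guidedWalk x ω) (n + 1) * f (guidedWalk x ω (n + 1)))
        ∂(noiseLaw p) =
      ∫⁻ ω, ENNReal.ofReal (avoidInd home (guidedWalk x ω) n *
        survOp p home [x (n + 1) - x n] f (guidedWalk x ω n)) ∂(noiseLaw p) := by
  set k : ℤ × ℤ → ℤ × ℤ → ℝ := fun y s => if y + s = home then 0 else f (y + s)
  have hk : ∀ y s, 0 ≤ k y s := fun y s => ite_nonneg le_rfl (hf _)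
  set F : (ℕ → Bool × (ℤ × ℤ)) → Bool × (ℤ × ℤ) → ℝ≥0∞ := fun ω e =>
    ENNReal.ofReal (avoidInd home (guidedWalk x ω) n *
      k (guidedWalk x ω n) (if e.1 then e.2 else x (n + 1) - x n))
  have hF : DependsOn F (Finset.range n : Set ℕ) := fun ω ω' h => by
    have hpath : ∀ t ∈ Finset.range (n + 1), guidedWalk x ω t = guidedWalk x ω' t := fun t ht =>
      dependsOn_guidedWalk x t fun i hi =>
        h i (Finset.range_mono (Finset.mem_range_succ_iff.1 ht) hi)
    simp only [F, dependsOn_avoidInd n hpath, hpath n (Finset.self_mem_range_succ n)]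
  calc _ = ∫⁻ ω, F ω (ω n) ∂(noiseLaw p) := by
        refine lintegral_congr fun ω => ?_
        rw [avoidInd_succ_mul, guidedWalk]
    _ = ∫⁻ ω, ∫⁻ e, F ω e ∂(stepNoiseLaw p) ∂(noiseLaw p) :=
        lintegral_infinitePi_eval _ Finset.notMem_range_self hF
    _ = _ := by
        refine lintegral_congr fun ω => ?_
        simp only [F, ENNReal.ofReal_mul (avoidInd_nonneg _ _)]
        rw [lintegral_const_mul _ Measurable.of_discrete,
          lintegral_stepNoiseLaw_step p (hk _), survOp_singleton]

theorem lintegral_noiseLaw_avoidInd (p : unitInterval) (l : List (ℤ × ℤ)) {x : ℕ → ℤ × ℤ}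
    (hx : ∀ t ≤ l.length, x t = (l.take t).sum) {f : ℤ × ℤ → ℝ} (hf : 0 ≤ f) :
    ∫⁻ ω, ENNReal.ofReal (avoidInd home (guidedWalk x ω) l.length * f (guidedWalk x ω l.length))
      ∂(noiseLaw p) = ENNReal.ofReal (survOp p home l f 0) := by
  induction l using List.reverseRecOn generalizing f with
  | nil => simp [avoidInd, survOp_nil, guidedWalk]
  | append_singleton l d ih =>
    simp only [List.length_append, List.length_singleton] at hx ⊢
    have hx' : ∀ t ≤ l.length, x t = (l.take t).sum := fun t ht => by
      rw [hx t (ht.trans (Nat.le_succ _)), List.take_append_of_le_length ht]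
    have hd : x (l.length + 1) - x l.length = d := by
      rw [hx _ le_rfl, hx' _ le_rfl, List.take_length_add_append]
      simp
    rw [survOp_append, ← ih hx' (survOp_nonneg p.2 [d] hf),
      lintegral_noiseLaw_avoidInd_succ p x _ hf, hd]

end Avoid

namespace SweepParams

variable {P : SweepParams} {home : ℤ × ℤ}

theorem dependsOn_instructions (i : ℕ) :
    DependsOn (P.instructions · i) (Finset.range i : Set ℕ) := by
  induction i with
  | zero => exact fun _ _ _ => rfl
  | succ i ih =>
    intro z z' h
    have hprev := ih fun j hj => h j (Finset.range_mono i.le_succ hj)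
    simp only [instructions, hprev, h i (Finset.self_mem_range_succ i)]

theorem lintegral_uniformOn_survOp (p : unitInterval) {t : ℕ} (ht : 1 ≤ t) (l : List (ℤ × ℤ))
    {f : ℤ × ℤ → ℝ} (hf : 0 ≤ f) (x : ℤ × ℤ) :
    ∫⁻ z, ENNReal.ofReal (survOp p home l (survOp p home (P.phase t z) f) x)
        ∂(uniformOn (Set.Icc 1 (P.M t))) =
      ENNReal.ofReal (survOp p home l (P.phaseOp p home t f) x) := by
  have hM : (0 : ℝ) < P.M t := by exact_mod_cast P.one_le_M ht
  have hnonneg : ∀ z, 0 ≤ survOp p home l (survOp p home (P.phase t z) f) x := fun z =>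
    survOp_nonneg p.2 l (survOp_nonneg p.2 _ hf) x
  rw [← Finset.coe_Icc, lintegral_uniformOn_finset,
    ← ENNReal.ofReal_sum_of_nonneg fun z _ => hnonneg z, Nat.card_Icc, Nat.add_sub_cancel,
    ← ENNReal.ofReal_natCast, ← ENNReal.ofReal_inv_of_pos hM, ← ENNReal.ofReal_mul (by positivity)]
  simp [phaseOp, LinearMap.sum_apply, Finset.sum_apply]

theorem lintegral_offsetLaw_survOp (p : unitInterval) (i : ℕ) {f : ℤ × ℤ → ℝ} (hf : 0 ≤ f) :
    ∫⁻ z, ENNReal.ofReal (survOp p home (P.instructions z i) f 0) ∂P.offsetLaw =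
      ENNReal.ofReal (P.survFunctional p home i f) := by
  induction i generalizing f with
  | zero => simp [instructions, survFunctional]
  | succ i ih =>
    have hphase : 0 ≤ P.phaseOp p home (P.startTime i) f := by
      simpa using phaseOp_mono (P := P) (home := home) p.2 (P.startTime i) hf
    rw [survFunctional_succ, ← ih hphase]
    simp only [instructions, survOp_append]
    rw [offsetLaw, lintegral_infinitePi_eval _ (Finset.notMem_range_self (n := i))
      (F := fun z e => ENNReal.ofReal (survOp p home (P.instructions z i)
        (survOp p home (P.phase (P.startTime i) e) f) 0))
      fun z z' h => by simp only [dependsOn_instructions (P := P) i h]]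
    exact lintegral_congr fun z =>
      lintegral_uniformOn_survOp p (one_le_two.trans (P.two_le_startTime i)) _ hf 0

theorem ae_offset_le (P : SweepParams) : ∀ᵐ z ∂P.offsetLaw, ∀ i, z i ≤ P.M (P.startTime i) :=
  ae_all_iff.2 fun i =>
    (measurePreserving_eval_infinitePi (fun i => uniformOn (Set.Icc 1 (P.M (P.startTime i))))
      i).quasiMeasurePreserving.ae (p := fun e => e ≤ P.M (P.startTime i))
      ((ae_cond_mem measurableSet_Icc).mono fun _ he => he.2)

theorem length_instructions {z : ℕ → ℕ} (hz : ∀ i, z i ≤ P.M (P.startTime i)) (i : ℕ) :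
    (P.instructions z i).length = P.startTime i := by
  induction i with
  | zero => rfl
  | succ i ih => rw [instructions, List.length_append, ih, startTime_succ, length_phase (hz i)]

theorem instructions_prefix (z : ℕ → ℕ) {i j : ℕ} (hij : i ≤ j) :
    P.instructions z i <+: P.instructions z j := by
  induction j, hij using Nat.le_induction with
  | base => exact List.prefix_rfl
  | succ j _ ih => exact ih.trans (List.prefix_append _ _)

theorem sweepWalk_eq {z : ℕ → ℕ} (hz : ∀ i, z i ≤ P.M (P.startTime i)) {i t : ℕ}
    (ht : t ≤ (P.instructions z i).length) :
    P.sweepWalk z t = ((P.instructions z i).take t).sum := by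
  have ht' : t ≤ (P.instructions z t).length := by
    rw [length_instructions hz]
    exact P.strictMono_startTime.le_apply
  rw [sweepWalk]
  rcases le_total t i with hti | hit
  · obtain ⟨r, hr⟩ := P.instructions_prefix z hti
    rw [← hr, List.take_append_of_le_length ht']
  · obtain ⟨r, hr⟩ := P.instructions_prefix z hit
    rw [← hr, List.take_append_of_le_length ht]

theorem measurable_sweepWalk (P : SweepParams) (t : ℕ) : Measurable (P.sweepWalk · t) :=
  measurable_of_dependsOn (s := Finset.range t) fun z z' h => by
    simp only [sweepWalk, dependsOn_instructions (P := P) t h]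

/-- The probability that the guided random walk following the sweeping strategy does not visit
`home` at the times `1, …, n`. -/
noncomputable def survProb (P : SweepParams) (p : unitInterval) (home : ℤ × ℤ) (n : ℕ) : ℝ≥0∞ :=
  ∫⁻ q, ENNReal.ofReal (avoidInd home (guidedWalk (P.sweepWalk q.1) q.2) n) ∂(P.law p)

theorem measurable_avoidInd_sweepWalk (n : ℕ) :
    Measurable fun q : (ℕ → ℕ) × (ℕ → Bool × (ℤ × ℤ)) =>
      ENNReal.ofReal (avoidInd home (guidedWalk (P.sweepWalk q.1) q.2) n) :=
  (measurable_avoidInd (measurable_guidedWalk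
    (fun t => (P.measurable_sweepWalk t).comp measurable_fst)
    fun t => (measurable_pi_apply t).comp measurable_snd) n).ennreal_ofReal

theorem survProb_startTime (p : unitInterval) (i : ℕ) :
    P.survProb p home (P.startTime i) = ENNReal.ofReal (P.survFunctional p home i 1) := by
  rw [survProb, law, lintegral_prod _ (measurable_avoidInd_sweepWalk _).aemeasurable,
    ← lintegral_offsetLaw_survOp p i zero_le_one]
  refine lintegral_congr_ae (P.ae_offset_le.mono fun z hz => ?_)
  simpa only [Pi.one_apply, mul_one, length_instructions hz] using
    lintegral_noiseLaw_avoidInd p (P.instructions z i) (x := P.sweepWalk z)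
      (fun t ht => sweepWalk_eq hz ht) zero_le_one

theorem survProb_zero (p : unitInterval) : P.survProb p home 0 = 1 := by
  simp [survProb, avoidInd]

theorem survProb_antitone (p : unitInterval) : Antitone (P.survProb p home) := fun _ _ h =>
  lintegral_mono fun _ => ENNReal.ofReal_le_ofReal (avoidInd_antitone _ h)

end SweepParams

theorem hittingTime_le_tsum (X : ℕ → ℤ × ℤ) (home : ℤ × ℤ) :
    hittingTime X home ≤ ∑' n, ENNReal.ofReal (avoidInd home X n) := by
  classical
  have hone : ∀ n, (∀ t ≤ n, X t ≠ home) → ENNReal.ofReal (avoidInd home X n) = 1 := fun n h => by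
    rw [avoidInd, Finset.prod_eq_one fun t ht => if_neg (h _ (Finset.mem_range.1 ht)),
      ENNReal.ofReal_one]
  by_cases hit : ∃ t, X t = home
  · calc hittingTime X home ≤ Nat.find hit :=
        iInf₂_le (f := fun t (_ : X t = home) => (t : ℝ≥0∞)) _ (Nat.find_spec hit)
      _ = ∑ n ∈ Finset.range (Nat.find hit), ENNReal.ofReal (avoidInd home X n) := by
        rw [Finset.sum_congr rfl fun n hn => hone n fun t htn =>
          Nat.find_min hit (htn.trans_lt (Finset.mem_range.1 hn))]
        simp
      _ ≤ _ := ENNReal.sum_le_tsum _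
  · push Not at hit
    simp only [fun n => hone n fun t _ => hit t]
    rw [ENNReal.tsum_const_eq_top_of_ne_zero one_ne_zero]
    exact le_top

theorem SweepParams.expectedHittingTime_le_tsum (P : SweepParams) (p : unitInterval)
    (home : ℤ × ℤ) : P.expectedHittingTime p home ≤ ∑' n, P.survProb p home n :=
  (lintegral_mono fun _ => hittingTime_le_tsum _ _).trans_eq
    (lintegral_tsum fun n => (measurable_avoidInd_sweepWalk n).aemeasurable)

theorem tsum_le_sum_range_add_tsum {u v : ℕ → ℝ≥0∞} (hu : Antitone u)
    (hv : ∀ ⦃m n⦄, 1 < m → m ≤ n → v n ≤ v m) {T : ℕ → ℕ} (hpos : ∀ i, 0 < T i)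
    (hT : StrictMono T) (huv : ∀ i, u (T i) ≤ v (T (i + 1))) :
    ∑' n, u n ≤ ∑ n ∈ Finset.range (T 0), u n + ∑' n, v n := by
  refine (ENNReal.le_tsum_schlomilch (fun _ _ _ h => hu h) hpos hT).trans (add_le_add le_rfl ?_)
  refine ENNReal.tsum_le_of_sum_range_le fun n => ?_
  calc ∑ i ∈ Finset.range n, ((T (i + 1) : ℝ≥0∞) - T i) * u (T i)
      ≤ ∑ i ∈ Finset.range n, (T (i + 1) - T i) • v (T (i + 1)) :=
        Finset.sum_le_sum fun i _ => by
          rw [nsmul_eq_mul, ENNReal.natCast_sub]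
          gcongr
          exact huv i
    _ ≤ ∑ k ∈ Finset.Ico (T 0 + 1) (T n + 1), v k :=
        Finset.sum_schlomilch_le' hv hpos hT.monotone n
    _ ≤ ∑' k, v k := ENNReal.sum_le_tsum _

theorem const_mul_rpow_neg_le {C h x y : ℝ} (hh : 0 ≤ h) (hx : 0 < x) (hy : 0 < y)
    (hyx : y ≤ 2 * x) : C * x ^ (-h) ≤ |C| * 2 ^ h * y ^ (-h) := by
  calc C * x ^ (-h) ≤ |C| * (y / 2) ^ (-h) :=
        mul_le_mul (le_abs_self C)
          (Real.rpow_le_rpow_of_nonpos (half_pos hy) (by linarith) (neg_nonpos.2 hh))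
          (by positivity) (abs_nonneg C)
    _ = |C| * 2 ^ h * y ^ (-h) := by
        rw [Real.div_rpow hy.le zero_le_two, Real.rpow_neg zero_le_two, div_inv_eq_mul]
        ring

open Filter in
theorem tsum_lt_top_of_le_rpow {u : ℕ → ℝ≥0∞} (hu : Antitone u) (hu0 : u 0 ≠ ∞) {T : ℕ → ℕ}
    (hT : StrictMono T) (hT2 : ∀ᶠ i in atTop, T (i + 1) ≤ 2 * T i) {h C : ℝ} (hh : 1 < h)
    (hC : ∀ᶠ i in atTop, u (T i) ≤ ENNReal.ofReal (C * (T i : ℝ) ^ (-h))) :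
    ∑' n, u n < ∞ := by
  obtain ⟨i₀, hi₀⟩ := eventually_atTop.1
    ((hT2.and hC).and (hT.tendsto_atTop.eventually_gt_atTop 0))
  set K := |C| * 2 ^ h
  have hK : 0 ≤ K := by positivity
  refine (tsum_le_sum_range_add_tsum hu (v := fun n => ENNReal.ofReal (K * (n : ℝ) ^ (-h)))
    (T := fun i => T (i₀ + i)) (fun m n hm hmn => ?_) (fun i => (hi₀ _ (Nat.le_add_right _ _)).2)
    (fun i j hij => hT (Nat.add_lt_add_left hij i₀)) fun i => ?_).trans_lt
    (ENNReal.add_lt_top.2 ⟨?_, ?_⟩)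
  · have hm0 : (0 : ℝ) < m := by exact_mod_cast one_pos.trans hm
    exact ENNReal.ofReal_le_ofReal (mul_le_mul_of_nonneg_left
      (Real.rpow_le_rpow_of_nonpos hm0 (by exact_mod_cast hmn) (by linarith)) hK)
  · obtain ⟨⟨hdouble, hdecay⟩, hpos⟩ := hi₀ (i₀ + i) (Nat.le_add_right _ _)
    refine hdecay.trans (ENNReal.ofReal_le_ofReal (const_mul_rpow_neg_le (by linarith)
      (by exact_mod_cast hpos) ?_ (by exact_mod_cast hdouble)))
    exact_mod_cast hpos.trans (hT (Nat.lt_succ_self _))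
  · exact ENNReal.sum_lt_top.2 fun n _ => (hu n.zero_le).trans_lt hu0.lt_top
  · exact ((Real.summable_nat_rpow.2 (by linarith)).mul_left K).tsum_ofReal_lt_top

namespace SweepParams

open Filter

theorem expectedHittingTime_lt_top {P : SweepParams} {p : unitInterval} {home : ℤ × ℤ}
    (hP : P.p₀ < 1) (hA : 0 < P.A) (hB : 0 < P.B) {h C : ℝ} (hh : 1 < h)
    (hC : ∀ᶠ i in atTop, P.survFunctional p home i 1 ≤ C * (P.startTime i : ℝ) ^ (-h)) :
    P.expectedHittingTime p home < ∞ := by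
  have hT := P.strictMono_startTime
  refine (P.expectedHittingTime_le_tsum p home).trans_lt (tsum_lt_top_of_le_rpow
    (survProb_antitone p) (by simp [survProb_zero]) hT ?_ (C := C) hh (hC.mono fun i hi => ?_))
  · filter_upwards [hT.tendsto_atTop.eventually
      (eventually_duration_le hP hA hB one_pos)] with i hi
    have : P.duration (P.startTime i) ≤ P.startTime i := by exact_mod_cast one_mul (_ : ℝ) ▸ hi
    rw [startTime_succ]
    omega
  · rw [survProb_startTime]
    exact ENNReal.ofReal_le_ofReal hi

theorem expectedHittingTime_lt_top_of_gain {a p₀ : ℝ} (ha : 0 < a) (hp₀ : p₀ ≤ 3 / 4)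
    (hgain : p₀ * √(3 - 2 * p₀) / (1 - p₀) ^ 2 ≤ gain a) {p : unitInterval} (hp : (p : ℝ) < p₀)
    (home : ℤ × ℤ) :
    expectedHittingTime
      { A := a * √(p₀ / 2 * (3 - 2 * p₀)), B := a * √(p₀ / 2), p₀ := p₀ } p home < ∞ := by
  set P : SweepParams := { A := a * √(p₀ / 2 * (3 - 2 * p₀)), B := a * √(p₀ / 2), p₀ := p₀ }
  have hp₀_pos : 0 < p₀ := p.2.1.trans_lt hp
  have hvar : 0 < 3 - 2 * p₀ := by linarith
  have hq : 0 < 1 - p₀ := by linarith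
  have hbox : 4 * (P.A / (1 - P.p₀)) * (P.B / (1 - P.p₀)) ≤ 1 - 4 * Real.exp (2 - a ^ 2 / 4) :=
    calc 4 * (P.A / (1 - P.p₀)) * (P.B / (1 - P.p₀))
        = 4 * a ^ 2 * √(p₀ / 2) ^ 2 * √(3 - 2 * p₀) / (1 - p₀) ^ 2 := by
          simp only [P]
          rw [Real.sqrt_mul (by positivity)]
          field_simp
      _ = 2 * a ^ 2 * (p₀ * √(3 - 2 * p₀) / (1 - p₀) ^ 2) := by
          rw [Real.sq_sqrt (by positivity)]
          ring
      _ ≤ 2 * a ^ 2 * gain a := by gcongr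
      _ = 1 - 4 * Real.exp (2 - a ^ 2 / 4) := by
          rw [gain, neg_div, neg_add_eq_sub]
          field_simp
  obtain ⟨h, hh, C, hC⟩ := exists_survFunctional_le (P := P) ha p.2.1 hp hp₀ rfl rfl hbox home
  refine expectedHittingTime_lt_top (by change p₀ < 1; linarith) ?_ ?_ hh hC
  · exact mul_pos ha (Real.sqrt_pos.2 (mul_pos (half_pos hp₀_pos) hvar))
  · exact mul_pos ha (Real.sqrt_pos.2 (half_pos hp₀_pos))

end SweepParams

theorem mainTheorem2 :
    ∃ a p₀ : ℝ,
      -- `a = 4.566…` is the maximizer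
      (4.566 ≤ a ∧ a < 4.567) ∧
      IsMaxOn (fun b : ℝ => 1 / (2 * b ^ 2) * (1 - 4 * Real.exp (-b ^ 2 / 4 + 2))) (Set.Ioi 0) a ∧
      -- `p₀ = 0.01139…` is the threshold
      (0.01139 ≤ p₀ ∧ p₀ < 0.01140) ∧
      p₀ * √(3 - 2 * p₀) / (1 - p₀) ^ 2 =
        1 / (2 * a ^ 2) * (1 - 4 * Real.exp (-a ^ 2 / 4 + 2)) ∧
      -- one strategy works for all error probabilities below `p₀` and all homes
      ∀ p : unitInterval, (p : ℝ) < p₀ → ∀ home : ℤ × ℤ,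
        SweepParams.expectedHittingTime
          { A := a * √(p₀ / 2 * (3 - 2 * p₀)), B := a * √(p₀ / 2), p₀ := p₀ } p home < ∞ := by
  obtain ⟨a, ⟨ha1, ha2⟩, hcrit⟩ := exists_isGainCritical
  have ha : 0 < a := by linarith
  obtain ⟨p₀, hp₀, heq⟩ := exists_threshold ha1 ha2
  rw [← gain_of_isGainCritical ha hcrit] at heq
  exact ⟨a, p₀, ⟨ha1, ha2⟩, isMaxOn_gain_of_isGainCritical ha hcrit, hp₀, heq, fun p hp =>
    SweepParams.expectedHittingTime_lt_top_of_gain ha (by linarith) heq.le hp⟩
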